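/- **Setting.** Let $(M,g)$ be a smooth four-dimensional spacetime: $g$ is a smooth metric of signature $(-+++)$, with Levi-Civita connection $\nabla$ and metric volume element $\eta$. Tensors and their metric equivalents are denoted by the same symbol. Let $W$ be the Weyl tensor, $Ric$ the Ricci tensor, $r$ its trace, and $2Q=Ric-\frac r6 g$. Write $(v,w)=g(v,w)$ for vectors and $(F,H)=\frac12F_{\alpha\beta}H^{\alpha\beta}$ for (real or complex) 2-forms, extended complex-bilinearly. Put $(v\wedge w)_{\alpha\beta}=v_\alpha w_\beta-w_\alpha v_\beta$ and $(*F)_{\alpha\beta}=\frac12\eta_{\alpha\beta\lambda\mu}F^{\lambda\mu}$; for a 3-form $T$, $(*T)_\alpha=\frac1{3!}\eta_{\alpha\beta\gamma\delta}T^{\beta\gamma\delta}$. For a 2-tensor $B$ let $B(x)_\alpha=B_{\alpha\beta}x^\beta$, and $(T\cdot x)_{\bar p}=T_{\bar p\alpha}x^\alpha$. Let $\mathrm{Sim}$ denote normalised symmetrisation, also indicated by round brackets on indices. **Type N.** Let $\mathcal W=\frac12(W-\mathrm i *W)$. The spacetime is of *type N* if, at every point, $W\neq0$ and $\mathcal W_{\alpha\beta\lambda\rho}\mathcal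 W^{\lambda\rho}{}_{\mu\nu}=0$. Then, locally, $\mathcal W=\mathcal L\otimes\mathcal L$ with $\mathcal L=\frac1{\sqrt2}(L-\mathrm i *L)$ for a real 2-form $L$, smooth and unique up to sign. There is a vector field $\ell$, smooth and unique up to sign, which is a common null eigenvector of $L$ and $*L$ with eigenvalue $0$ and satisfies $L=\ell\wedge e_2$ for some unit space-like $e_2$ orthogonal to $\ell$. We call $\mathcal L$ and $\ell$ the fundamental bivector and the fundamental vector (a time orientation fixes the sign of $\ell$). The vanishing of each of the quantities below does not depend on the signs of $L$ and $\ell$ nor on the orientation. **Invariants.** Let $x$ be an arbitrary time-like vector field. Define $$\mathcal F_1=\nabla_\ell\mathcal L,\qquad a=-\frac{1}{(\ell,x)}(\nabla L\cdot\ell)(x),\qquad a^*=\frac1{(\ell,x)}(\nabla{*L}\cdot\ell)(x),$$ $$\mathcal F_2=\nabla_a\mathcal L,\qquad \mathcal F_2^*=\nabla_{a^*}\mathcal L,\qquad \alpha=\frac{(a,x)}{(\ell,x)},\qquad \alpha^*=\frac{(a^*,x)}{(\ell,x)},$$ $$B=\nabla\ell+{}^t\nabla\ell,\qquad b=\frac1{(\ell,x)}\Big[B(x)-\frac{B(x,x)}{2(\ell,x)}\,\ell\Big],\qquad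 F_3=\mathrm d\ell,$$ $$C_{\alpha\beta\gamma}=\nabla_{(\alpha}{*L}_{\beta}{}^{\mu}L_{\gamma)\mu},\qquad c=\frac1{(\ell,x)^3}\big[3(\ell,x)\,C(x,x)-2\,C(x,x,x)\,\ell\big],$$ $$F_4=\ell\wedge c,\qquad F_5=\mathrm d b,\qquad f=\mathrm d\alpha-\alpha^*c,\qquad f^*=\mathrm d\alpha^*+\alpha c,$$ and $$\varphi_1=(\mathcal F_1,\mathcal F_1),\quad \varphi_2=|(\mathcal F_2,\mathcal F_2)|+|(\mathcal F_2^*,\mathcal F_2^*)|,\quad \varphi_3=(F_3,F_3),\quad \varphi_4=(F_4,F_4),\quad \varphi_5=(F_5,F_5),$$ $$\varphi_6=*(\ell\wedge f\wedge f^*),\qquad \varphi_7=*(\ell\wedge b\wedge c).$$ **Classes.** For $1\le n\le 7$, the type N spacetime is of *class $\mathrm Cn$* if $\varphi_i=0$ identically for all $i<n$, for every local choice of $L,\ell,x$, and $\varphi_n$ does not vanish identically. **Proposition.** Let $(M,g)$ be a type N spacetime with $6Q=\Lambda g$ for a real constant $\Lambda$ (equivalently, an Einstein space with $Ric=\Lambda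 g$). Then $(M,g)$ belongs to none of the classes $\mathrm C1$, $\mathrm C3$, $\mathrm C4$ and $\mathrm C6$. -/

import Mathlib

open scoped Manifold ContDiff

noncomputable section

namespace TypeNSpacetime

/-! ## Tensor calculus in one coordinate domain

All tensors are given by their fully covariant components, which are functions of the coordinates
and are only meaningful on an open set; indices are raised with the inverse metric. -/

/-- The coordinate space `ℝ⁴`. -/
abbrev Coord := EuclideanSpace ℝ (Fin 4)

/-- Components of a covector field, or of a vector field with its index lowered. -/
abbrev Tensor1 (A : Type) := Fin 4 → Coord → A

/-- Components of a twice covariant tensor field. -/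
abbrev Tensor2 (A : Type) := Fin 4 → Fin 4 → Coord → A

/-- Components of a three times covariant tensor field. -/
abbrev Tensor3 (A : Type) := Fin 4 → Fin 4 → Fin 4 → Coord → A

/-- Components of a four times covariant tensor field. -/
abbrev Tensor4 (A : Type) := Fin 4 → Fin 4 → Fin 4 → Fin 4 → Coord → A

/-- The partial derivative `∂ᵢ f`. -/
def pd {A : Type} [NormedAddCommGroup A] [NormedSpace ℝ A]
    (i : Fin 4) (f : Coord → A) (y : Coord) : A :=
  fderiv ℝ f y (EuclideanSpace.single i 1)

/-- The metric as a matrix at a point. -/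
def metricMatrix (g : Tensor2 ℝ) (y : Coord) : Matrix (Fin 4) (Fin 4) ℝ :=
  Matrix.of fun i j => g i j y

/-- The components `g^{ij}` of the inverse metric. -/
def ginv (g : Tensor2 ℝ) (i j : Fin 4) (y : Coord) : ℝ :=
  (metricMatrix g y)⁻¹ i j

/-- The contravariant components `v^i = g^{ij} v_j`. -/
def up (g : Tensor2 ℝ) (v : Tensor1 ℝ) (i : Fin 4) (y : Coord) : ℝ :=
  ∑ j, ginv g i j y * v j y

/-- The scalar product `(v, w) = g^{ij} v_i w_j`. -/
def inner1 (g : Tensor2 ℝ) (v w : Tensor1 ℝ) (y : Coord) : ℝ :=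
  ∑ i, ∑ j, ginv g i j y * v i y * w j y

/-- The scalar product of two 2-forms, `(F, H) = ½ F_{ij} H^{ij}`; it is bilinear (and not
sesquilinear) over the complex numbers. -/
def inner2 {A : Type} [NormedField A] [NormedAlgebra ℝ A]
    (g : Tensor2 ℝ) (F H : Tensor2 A) (y : Coord) : A :=
  (1 / 2 : ℝ) • ∑ i, ∑ j, ∑ k, ∑ l, (ginv g i k y * ginv g j l y) • (F i j y * H k l y)

/-- The wedge product of two covectors, `(v ∧ w)_{ij} = v_i w_j - w_i v_j`. -/
def wedge (v w : Tensor1 ℝ) : Tensor2 ℝ :=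
  fun i j y => v i y * w j y - w i y * v j y

/-- The exterior derivative of a 1-form, `(dv)_{ij} = ∂_i v_j - ∂_j v_i`. -/
def extDeriv1 (v : Tensor1 ℝ) : Tensor2 ℝ :=
  fun i j y => pd i (v j) y - pd j (v i) y

/-- The Levi-Civita symbol with `ε_{0123} = 1`. -/
def eps (i j k l : Fin 4) : ℤ :=
  Int.sign ((((j : ℕ) : ℤ) - ((i : ℕ) : ℤ)) * (((k : ℕ) : ℤ) - ((i : ℕ) : ℤ)) *
    (((l : ℕ) : ℤ) - ((i : ℕ) : ℤ)) * (((k : ℕ) : ℤ) - ((j : ℕ) : ℤ)) *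
    (((l : ℕ) : ℤ) - ((j : ℕ) : ℤ)) * (((l : ℕ) : ℤ) - ((k : ℕ) : ℤ)))

/-- The metric volume element `η`, for the orientation of the coordinate domain given by the sign
`o = ±1`. -/
def vol (g : Tensor2 ℝ) (o : ℝ) : Tensor4 ℝ :=
  fun i j k l y => o * √|(metricMatrix g y).det| * (eps i j k l : ℝ)

/-- The Hodge dual of a 2-form, `(*F)_{ij} = ½ η_{ijkl} F^{kl}`. -/
def hodge (g : Tensor2 ℝ) (o : ℝ) (F : Tensor2 ℝ) : Tensor2 ℝ :=
  fun i j y => 1 / 2 * ∑ k, ∑ l, ∑ m, ∑ n,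
    vol g o i j k l y * ginv g k m y * ginv g l n y * F m n y

/-- The Hodge dual of the 3-form `u ∧ v ∧ w`, namely the 1-form `η_{ijkl} u^j v^k w^l`. -/
def hodgeWedge3 (g : Tensor2 ℝ) (o : ℝ) (u v w : Tensor1 ℝ) : Tensor1 ℝ :=
  fun i y => ∑ j, ∑ k, ∑ l, vol g o i j k l y * up g u j y * up g v k y * up g w l y

/-- The Christoffel symbols `Γ^k_{ij}` of the Levi-Civita connection. -/
def christoffel (g : Tensor2 ℝ) (k i j : Fin 4) (y : Coord) : ℝ :=
  1 / 2 * ∑ l, ginv g k l y * (pd i (g l j) y + pd j (g i l) y - pd l (g i j) y)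

/-- The covariant derivative of a covector field, `nabla1 g v i j = ∇_i v_j`. -/
def nabla1 (g : Tensor2 ℝ) (v : Tensor1 ℝ) : Tensor2 ℝ :=
  fun i j y => pd i (v j) y - ∑ k, christoffel g k i j y * v k y

/-- The covariant derivative of a real or complex 2-tensor, `nabla2 g F i j k = ∇_i F_{jk}`. -/
def nabla2 {A : Type} [NormedField A] [NormedAlgebra ℝ A]
    (g : Tensor2 ℝ) (F : Tensor2 A) : Tensor3 A :=
  fun i j k y => pd i (F j k) y - ∑ l, christoffel g l i j y • F l k y
    - ∑ l, christoffel g l i k y • F j l y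

/-- The directional covariant derivative `∇_v F` of a 2-tensor. -/
def nablaAlong {A : Type} [NormedField A] [NormedAlgebra ℝ A]
    (g : Tensor2 ℝ) (v : Tensor1 ℝ) (F : Tensor2 A) : Tensor2 A :=
  fun j k y => ∑ i, up g v i y • nabla2 g F i j k y

/-- The Riemann tensor `R^i_{jkl}`. -/
def riemannUp (g : Tensor2 ℝ) (i j k l : Fin 4) (y : Coord) : ℝ :=
  pd k (christoffel g i l j) y - pd l (christoffel g i k j) y
    + ∑ m, (christoffel g i k m y * christoffel g m l j y
      - christoffel g i l m y * christoffel g m k j y)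

/-- The Riemann tensor `R_{ijkl}`. -/
def riemann (g : Tensor2 ℝ) : Tensor4 ℝ :=
  fun i j k l y => ∑ m, g i m y * riemannUp g m j k l y

/-- The Ricci tensor `R_{jl} = R^i_{jil}`. -/
def ricci (g : Tensor2 ℝ) : Tensor2 ℝ :=
  fun j l y => ∑ i, riemannUp g i j i l y

/-- The scalar curvature `r`. -/
def scalarCurv (g : Tensor2 ℝ) (y : Coord) : ℝ :=
  ∑ i, ∑ j, ginv g i j y * ricci g i j y

/-- The tensor `Q` with `2 Q = Ric - (r / 6) g`. -/
def tensorQ (g : Tensor2 ℝ) : Tensor2 ℝ :=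
  fun i j y => 1 / 2 * (ricci g i j y - scalarCurv g y / 6 * g i j y)

/-- The Weyl tensor `W`. -/
def weyl (g : Tensor2 ℝ) : Tensor4 ℝ :=
  fun i j k l y => riemann g i j k l y
    - (g i k y * tensorQ g j l y - g i l y * tensorQ g j k y
      + g j l y * tensorQ g i k y - g j k y * tensorQ g i l y)

/-- The dual `(*W)_{ijkl} = ½ η_{ijmn} W^{mn}_{kl}` of the Weyl tensor. -/
def weylDual (g : Tensor2 ℝ) (o : ℝ) : Tensor4 ℝ :=
  fun i j k l y => hodge g o (fun m n => weyl g m n k l) i j y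

/-- The self-dual Weyl tensor `𝒲 = ½ (W - i *W)`. -/
def selfDualWeyl (g : Tensor2 ℝ) (o : ℝ) : Tensor4 ℂ :=
  fun i j k l y => 1 / 2 * ((weyl g i j k l y : ℂ) - Complex.I * (weylDual g o i j k l y : ℂ))

/-- The square `(𝒲²)_{ijkl} = ½ 𝒲_{ijmn} 𝒲^{mn}_{kl}`. -/
def selfDualWeylSq (g : Tensor2 ℝ) (o : ℝ) : Tensor4 ℂ :=
  fun i j k l y => 1 / 2 * ∑ m, ∑ n, ∑ p, ∑ q, (ginv g m p y : ℂ) * (ginv g n q y : ℂ) *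
    selfDualWeyl g o i j m n y * selfDualWeyl g o p q k l y

/-- The Weyl tensor is of Petrov-Bel type N at a point: `𝒲² = 0` and `W ≠ 0`. -/
def IsTypeNAt (g : Tensor2 ℝ) (y : Coord) : Prop :=
  (∀ o : ℝ, o = 1 ∨ o = -1 → ∀ i j k l, selfDualWeylSq g o i j k l y = 0) ∧
    ∃ i j k l, weyl g i j k l y ≠ 0

/-- The self-dual bivector `(F - i *F) / √2` of a real 2-form `F`. -/
def bivector (g : Tensor2 ℝ) (o : ℝ) (F : Tensor2 ℝ) : Tensor2 ℂ :=
  fun i j y => ((1 / √2 : ℝ) : ℂ) * ((F i j y : ℂ) - Complex.I * (hodge g o F i j y : ℂ))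

/-- `ℓ` is, at the point `y`, the fundamental vector (for one of the two time orientations) of the
2-form `L`: it is the common null eigendirection of `L` and `*L`, normalised so that `L = ℓ ∧ e`
with `e` a unit space-like vector orthogonal to `ℓ`. -/
def IsFundamentalVectorAt (g : Tensor2 ℝ) (o : ℝ) (L : Tensor2 ℝ) (ℓ : Tensor1 ℝ)
    (y : Coord) : Prop :=
  inner1 g ℓ ℓ y = 0 ∧
  (∀ i, ∑ j, L i j y * up g ℓ j y = 0) ∧
  (∀ i, ∑ j, hodge g o L i j y * up g ℓ j y = 0) ∧
  ∃ e : Tensor1 ℝ, inner1 g e e y = 1 ∧ inner1 g ℓ e y = 0 ∧ ∀ i j, L i j y = wedge ℓ e i j y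

/-- The fundamental elements of a type N Weyl tensor are determined by the metric up to sign, once
an orientation is chosen.  This structure is one smooth choice of them on an open subset `V` of the
coordinate domain `U`, together with one of the arbitrary time-like vector fields `x` that occur in
the formulas for the invariants. -/
structure FundamentalData (U : Set Coord) (g : Tensor2 ℝ) where
  /-- the open set where the choice is made -/
  V : Set Coord
  isOpen_V : IsOpen V
  V_subset : V ⊆ U
  /-- the orientation -/
  o : ℝ
  o_eq : o = 1 ∨ o = -1
  /-- the fundamental 2-form -/
  L : Tensor2 ℝ
  /-- the fundamental vector -/
  ℓ : Tensor1 ℝ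
  /-- the auxiliary time-like vector field -/
  x : Tensor1 ℝ
  smooth_L : ∀ i j, ContDiffOn ℝ ∞ (L i j) V
  smooth_ℓ : ∀ i, ContDiffOn ℝ ∞ (ℓ i) V
  smooth_x : ∀ i, ContDiffOn ℝ ∞ (x i) V
  antisymm_L : ∀ y ∈ V, ∀ i j, L i j y = - L j i y
  weyl_eq : ∀ y ∈ V, ∀ i j k l,
    selfDualWeyl g o i j k l y = bivector g o L i j y * bivector g o L k l y
  fundamental_ℓ : ∀ y ∈ V, IsFundamentalVectorAt g o L ℓ y
  timelike_x : ∀ y ∈ V, inner1 g x x y < 0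

namespace FundamentalData

variable {U : Set Coord} {g : Tensor2 ℝ}

/-- The fundamental bivector `𝓛 = (L - i *L) / √2`. -/
def calL (S : FundamentalData U g) : Tensor2 ℂ := bivector g S.o S.L

/-- The scalar `(ℓ, x)`. -/
def lx (S : FundamentalData U g) (y : Coord) : ℝ := inner1 g S.ℓ S.x y

/-- `𝓕₁ = ∇_ℓ 𝓛`. -/
def F1 (S : FundamentalData U g) : Tensor2 ℂ := nablaAlong g S.ℓ S.calL

/-- `a = - (ℓ, x)⁻¹ (∇L · ℓ)(x)`. -/
def a (S : FundamentalData U g) : Tensor1 ℝ :=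
  fun i y => - (1 / S.lx y) *
    ∑ j, ∑ k, nabla2 g S.L i j k y * up g S.ℓ k y * up g S.x j y

/-- `a* = (ℓ, x)⁻¹ (∇*L · ℓ)(x)`. -/
def aStar (S : FundamentalData U g) : Tensor1 ℝ :=
  fun i y => (1 / S.lx y) *
    ∑ j, ∑ k, nabla2 g (hodge g S.o S.L) i j k y * up g S.ℓ k y * up g S.x j y

/-- `𝓕₂ = ∇_a 𝓛`. -/
def F2 (S : FundamentalData U g) : Tensor2 ℂ := nablaAlong g S.a S.calL

/-- `𝓕₂* = ∇_{a*} 𝓛`. -/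
def F2Star (S : FundamentalData U g) : Tensor2 ℂ := nablaAlong g S.aStar S.calL

/-- `α = (a, x) / (ℓ, x)`. -/
def alpha (S : FundamentalData U g) (y : Coord) : ℝ := inner1 g S.a S.x y / S.lx y

/-- `α* = (a*, x) / (ℓ, x)`. -/
def alphaStar (S : FundamentalData U g) (y : Coord) : ℝ := inner1 g S.aStar S.x y / S.lx y

/-- `B = ∇ℓ + ᵗ∇ℓ`. -/
def B (S : FundamentalData U g) : Tensor2 ℝ :=
  fun i j y => nabla1 g S.ℓ i j y + nabla1 g S.ℓ j i y

/-- The covector `B(x)`. -/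
def Bx (S : FundamentalData U g) : Tensor1 ℝ := fun i y => ∑ j, S.B i j y * up g S.x j y

/-- `b = (ℓ, x)⁻¹ [B(x) - B(x, x) / (2 (ℓ, x)) ℓ]`. -/
def b (S : FundamentalData U g) : Tensor1 ℝ :=
  fun i y => (1 / S.lx y) *
    (S.Bx i y - (∑ j, S.Bx j y * up g S.x j y) / (2 * S.lx y) * S.ℓ i y)

/-- `F₃ = dℓ`. -/
def F3 (S : FundamentalData U g) : Tensor2 ℝ := extDeriv1 S.ℓ

/-- The tensor `∇_i (*L)_j^m L_{km}`, before symmetrisation. -/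
def preC (S : FundamentalData U g) : Tensor3 ℝ :=
  fun i j k y => ∑ m, ∑ n,
    nabla2 g (hodge g S.o S.L) i j n y * ginv g n m y * S.L k m y

/-- `C_{ijk} = ∇_{(i} (*L)_j^m L_{k)m}`, with the normalised symmetrisation. -/
def C (S : FundamentalData U g) : Tensor3 ℝ :=
  fun i j k y => 1 / 6 * (S.preC i j k y + S.preC i k j y + S.preC j i k y
    + S.preC j k i y + S.preC k i j y + S.preC k j i y)

/-- The covector `C(x, x)`. -/
def Cxx (S : FundamentalData U g) : Tensor1 ℝ :=
  fun i y => ∑ j, ∑ k, S.C i j k y * up g S.x j y * up g S.x k y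

/-- `c = (ℓ, x)⁻³ [3 (ℓ, x) C(x, x) - 2 C(x, x, x) ℓ]`. -/
def c (S : FundamentalData U g) : Tensor1 ℝ :=
  fun i y => (1 / S.lx y ^ 3) *
    (3 * S.lx y * S.Cxx i y - 2 * (∑ j, S.Cxx j y * up g S.x j y) * S.ℓ i y)

/-- `F₄ = ℓ ∧ c`. -/
def F4 (S : FundamentalData U g) : Tensor2 ℝ := wedge S.ℓ S.c

/-- `F₅ = db`. -/
def F5 (S : FundamentalData U g) : Tensor2 ℝ := extDeriv1 S.b

/-- `f = dα - α* c`. -/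
def f (S : FundamentalData U g) : Tensor1 ℝ :=
  fun i y => pd i S.alpha y - S.alphaStar y * S.c i y

/-- `f* = dα* + α c`. -/
def fStar (S : FundamentalData U g) : Tensor1 ℝ :=
  fun i y => pd i S.alphaStar y + S.alpha y * S.c i y

/-- `φ₁ = (𝓕₁, 𝓕₁)`. -/
def phi1 (S : FundamentalData U g) (y : Coord) : ℂ := inner2 g S.F1 S.F1 y

/-- `φ₂ = |(𝓕₂, 𝓕₂)| + |(𝓕₂*, 𝓕₂*)|`. -/
def phi2 (S : FundamentalData U g) (y : Coord) : ℝ :=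
  ‖inner2 g S.F2 S.F2 y‖ + ‖inner2 g S.F2Star S.F2Star y‖

/-- `φ₃ = (F₃, F₃)`. -/
def phi3 (S : FundamentalData U g) (y : Coord) : ℝ := inner2 g S.F3 S.F3 y

/-- `φ₄ = (F₄, F₄)`. -/
def phi4 (S : FundamentalData U g) (y : Coord) : ℝ := inner2 g S.F4 S.F4 y

/-- `φ₅ = (F₅, F₅)`. -/
def phi5 (S : FundamentalData U g) (y : Coord) : ℝ := inner2 g S.F5 S.F5 y

/-- `φ₆ = *(ℓ ∧ f ∧ f*)`. -/
def phi6 (S : FundamentalData U g) : Tensor1 ℝ := hodgeWedge3 g S.o S.ℓ S.f S.fStar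

/-- `φ₇ = *(ℓ ∧ b ∧ c)`. -/
def phi7 (S : FundamentalData U g) : Tensor1 ℝ := hodgeWedge3 g S.o S.ℓ S.b S.c

/-- The statement `φ_n = 0` at the point `y`, for `n = 1, …, 7` (no condition for other `n`). -/
def PhiVanishesAt (S : FundamentalData U g) (y : Coord) : ℕ → Prop
  | 1 => S.phi1 y = 0
  | 2 => S.phi2 y = 0
  | 3 => S.phi3 y = 0
  | 4 => S.phi4 y = 0
  | 5 => S.phi5 y = 0
  | 6 => ∀ i, S.phi6 i y = 0
  | 7 => ∀ i, S.phi7 i y = 0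
  | _ => True

end FundamentalData

/-! ## Lorentzian metrics on four-dimensional manifolds -/

section Manifold

variable {M : Type*} [TopologicalSpace M] [ChartedSpace Coord M]

/-- The components in the chart `φ` of a field of bilinear forms on the tangent spaces. -/
def chartComponents (g : ∀ p : M, LinearMap.BilinForm ℝ (TangentSpace (𝓡 4) p))
    (φ : OpenPartialHomeomorph M Coord) : Tensor2 ℝ :=
  fun i j y => g (φ.symm y)
    (mfderiv (𝓡 4) (𝓡 4) φ.symm y (EuclideanSpace.single i (1 : ℝ) : Coord))
    (mfderiv (𝓡 4) (𝓡 4) φ.symm y (EuclideanSpace.single j (1 : ℝ) : Coord))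

variable (M) in
/-- A smooth Lorentzian metric of signature `(-+++)` on a smooth four-dimensional manifold. -/
structure LorentzMetric where
  /-- the scalar product on each tangent space -/
  val : ∀ p : M, LinearMap.BilinForm ℝ (TangentSpace (𝓡 4) p)
  symm : ∀ (p : M) (v w : TangentSpace (𝓡 4) p), val p v w = val p w v
  signature : ∀ p : M, ∃ e : Module.Basis (Fin 4) ℝ (TangentSpace (𝓡 4) p),
    ∀ s t, val p (e s) (e t) = if s = t then (if s = 0 then -1 else 1) else 0
  smooth : ∀ φ ∈ IsManifold.maximalAtlas (𝓡 4) ∞ M, ∀ i j,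
    ContDiffOn ℝ ∞ (chartComponents val φ i j) φ.target

namespace LorentzMetric

/-- The components of the metric in a chart. -/
def comp (g : LorentzMetric M) (φ : OpenPartialHomeomorph M Coord) : Tensor2 ℝ :=
  chartComponents g.val φ

/-- The spacetime is of type N: its Weyl tensor is of type N at every point. -/
def IsTypeN (g : LorentzMetric M) : Prop :=
  ∀ φ ∈ IsManifold.maximalAtlas (𝓡 4) ∞ M, ∀ y ∈ φ.target, IsTypeNAt (g.comp φ) y

/-- `6 Q = Λ g`. -/
def IsEinstein (g : LorentzMetric M) (Λ : ℝ) : Prop :=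
  ∀ φ ∈ IsManifold.maximalAtlas (𝓡 4) ∞ M, ∀ y ∈ φ.target, ∀ i j,
    6 * tensorQ (g.comp φ) i j y = Λ * g.comp φ i j y

/-- `φ_n = 0` identically on the spacetime. -/
def PhiVanishes (g : LorentzMetric M) (n : ℕ) : Prop :=
  ∀ φ ∈ IsManifold.maximalAtlas (𝓡 4) ∞ M, ∀ S : FundamentalData φ.target (g.comp φ),
    ∀ y ∈ S.V, S.PhiVanishesAt y n

/-- A type N spacetime is of class `Cn` if `φ_m = 0` for all `m < n` and `φ_n ≠ 0` (that is, `φ_n`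
does not vanish identically). -/
def IsClassC (g : LorentzMetric M) (n : ℕ) : Prop :=
  g.IsTypeN ∧ (∀ m < n, g.PhiVanishes m) ∧ ¬ g.PhiVanishes n

end LorentzMetric

end Manifold

end TypeNSpacetime

end

/-!
A type N Einstein space is studied in the null frame `E = (ℓ, e, f, n)` in which the fundamental
2-form and its dual are `L = ℓ ∧ e` and `*L = ℓ ∧ f`. The auxiliary time-like field `x` selects
one such frame, namely the one with `e` and `f` orthogonal to `x`, and it is smooth because its
members are contractions of `L` and `*L` with `x` (`FundamentalData.isAdaptedFrame`). Write
`∇ℓ = θ ⊗ ℓ + a ⊗ e + a' ⊗ f` and let `ω = (f, ∇e)`; these are four of the six connection 1-forms.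
Then `a` and `-a'` are the vectors `a` and `a*`, and, with `α = (a, x) / (ℓ, x)` and
`α' = (a', x) / (ℓ, x)`,
`b = θ + α e + α' f`, `c = - ω - α f + α' e`.

The curvature is `R_ijkl = L_ij L_kl - *L_ij *L_kl + Λ/3 (g_ik g_jl - g_il g_jk)`, and the second
Bianchi identity for it gives three identities between 3-forms,
`a ∧ L = a' ∧ *L`, `a' ∧ L + a ∧ *L = 0`, `2 θ ∧ L + 2 ω ∧ *L + a ∧ ℓ ∧ n = a' ∧ e ∧ f`.
They say that `ℓ` is geodesic and free of shear, and that its expansion and twist are multiples of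
`(θ, ℓ)` and `(ω, ℓ)` (`IsTypeNFrame.optical_scalars`).

The square of `∇_v 𝓛` is `-((a, v) - i (a', v))²`, since `𝓛` is null and orthogonal to the other
self-dual bivectors that occur in it (`IsNullFrame.inner2_nablaAlong`). For `v = ℓ` it vanishes,
which is `φ₁ = 0`. For `v = a` its vanishing forces `(a, a) = 0`, so that expansion and twist vanish:
`a = α ℓ`, `a' = α' ℓ`, `(θ, ℓ) = (ω, ℓ) = 0`. Hence `dℓ = (θ - α e - α' f) ∧ ℓ` and `ℓ ∧ c` are null,
which is `φ₃ = φ₄ = 0`.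

Finally the curvature forms of the pairs `(ℓ, e)` and `(ℓ, f)` give `dα` and `dα'` modulo `ℓ`. With
`K = α² + α'² + Λ/3` one finds `db = K ℓ ∧ n` up to terms `ℓ ∧ e`, `ℓ ∧ f`, so `φ₅ = -K²`, while
the 1-form `dα - α* c` is congruent to `K e` modulo `ℓ`. Thus `φ₅ = 0` implies `K = 0`; then the
exterior product of `ℓ` and `dα - α* c` vanishes, and with it `φ₆`.
-/

open scoped Manifold ContDiff

noncomputable section

namespace TypeNSpacetime

/-! ### Partial derivatives -/

section PartialDerivatives

variable {V : Set Coord} {y : Coord}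

lemma pd_congr {A : Type} [NormedAddCommGroup A] [NormedSpace ℝ A] (hV : IsOpen V) (hy : y ∈ V)
    {f h : Coord → A} (hfh : ∀ z ∈ V, f z = h z) (i : Fin 4) : pd i f y = pd i h y := by
  have : f =ᶠ[nhds y] h := Filter.eventually_of_mem (hV.mem_nhds hy) hfh
  simp only [pd, this.fderiv_eq]

lemma pd_const (c : ℝ) (i : Fin 4) : pd i (fun _ : Coord => c) y = 0 := by
  simp [pd]

lemma pd_add {f h : Coord → ℝ} (hf : DifferentiableAt ℝ f y) (hh : DifferentiableAt ℝ h y)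
    (i : Fin 4) : pd i (fun z => f z + h z) y = pd i f y + pd i h y := by
  simp [pd, fderiv_fun_add hf hh]

lemma pd_sub {f h : Coord → ℝ} (hf : DifferentiableAt ℝ f y) (hh : DifferentiableAt ℝ h y)
    (i : Fin 4) : pd i (fun z => f z - h z) y = pd i f y - pd i h y := by
  simp [pd, fderiv_fun_sub hf hh]

lemma pd_mul {f h : Coord → ℝ} (hf : DifferentiableAt ℝ f y) (hh : DifferentiableAt ℝ h y)
    (i : Fin 4) : pd i (fun z => f z * h z) y = pd i f y * h y + f y * pd i h y := by
  simp [pd, fderiv_fun_mul hf hh]; ring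

lemma pd_const_mul {f : Coord → ℝ} (hf : DifferentiableAt ℝ f y) (c : ℝ)
    (i : Fin 4) : pd i (fun z => c * f z) y = c * pd i f y := by
  simp [pd, fderiv_const_mul hf]

lemma pd_sum {ι : Type} [Fintype ι] {f : ι → Coord → ℝ} (hf : ∀ b, DifferentiableAt ℝ (f b) y)
    (i : Fin 4) : pd i (fun z => ∑ b, f b z) y = ∑ b, pd i (f b) y := by
  simp [pd, fderiv_fun_sum (fun b _ => hf b)]

lemma pd_sum_mul {f h : Fin 4 → Coord → ℝ} (hf : ∀ b, DifferentiableAt ℝ (f b) y)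
    (hh : ∀ b, DifferentiableAt ℝ (h b) y) (i : Fin 4) :
    pd i (fun z => ∑ b, f b z * h b z) y = ∑ b, (pd i (f b) y * h b y + f b y * pd i (h b) y) := by
  rw [pd_sum (f := fun b z => f b z * h b z) fun b => (hf b).mul (hh b)]
  exact Finset.sum_congr rfl fun b _ => pd_mul (hf b) (hh b) i

lemma contDiffOn_pd {f : Coord → ℝ} (hV : IsOpen V) (hf : ContDiffOn ℝ ∞ f V) (i : Fin 4) :
    ContDiffOn ℝ ∞ (pd i f) V :=
  (hf.fderiv_of_isOpen hV (by simp)).clm_apply contDiffOn_const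

lemma differentiableAt_of_smooth {A : Type} [NormedAddCommGroup A] [NormedSpace ℝ A]
    {f : Coord → A} (hV : IsOpen V) (hf : ContDiffOn ℝ ∞ f V)
    (hy : y ∈ V) : DifferentiableAt ℝ f y :=
  (hf.contDiffAt (hV.mem_nhds hy)).differentiableAt (by simp)

lemma pd_comm {f : Coord → ℝ} (hV : IsOpen V) (hf : ContDiffOn ℝ ∞ f V) (hy : y ∈ V)
    (i j : Fin 4) : pd i (pd j f) y = pd j (pd i f) y := by
  have h2 : DifferentiableAt ℝ (fderiv ℝ f) y :=
    differentiableAt_of_smooth hV (hf.fderiv_of_isOpen hV (m := ∞) (by simp)) hy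
  have hs := (hf.contDiffAt (hV.mem_nhds hy)).isSymmSndFDerivAt
    (by simp only [minSmoothness_of_isRCLikeNormedField]; exact ENat.LEInfty.out)
  have key : ∀ i j, pd i (pd j f) y =
      fderiv ℝ (fderiv ℝ f) y (EuclideanSpace.single i 1) (EuclideanSpace.single j 1) := by
    intro i j
    have : pd j f = fun z => fderiv ℝ f z (EuclideanSpace.single j 1) := rfl
    rw [this, pd, fderiv_clm_apply h2 (by fun_prop)]
    simp
  rw [key, key, hs.eq]

end PartialDerivatives

/-! ### Lorentzian metrics on a coordinate domain -/

/-- `g` is a smooth Lorentzian metric of signature `(-+++)` on the coordinate domain `U`. -/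
structure LorentzOn (g : Tensor2 ℝ) (U : Set Coord) : Prop where
  smooth : ∀ i j, ContDiffOn ℝ ∞ (g i j) U
  symm : ∀ y ∈ U, ∀ i j, g i j y = g j i y
  lorentz : ∀ y ∈ U, ∃ P : Matrix (Fin 4) (Fin 4) ℝ, P.det ≠ 0 ∧
    metricMatrix g y = P.transpose * Matrix.diagonal ![-1, 1, 1, 1] * P

lemma contDiffOn_det {V : Set Coord} {m : Fin 4 → Fin 4 → Coord → ℝ}
    (h : ∀ i j, ContDiffOn ℝ ∞ (m i j) V) :
    ContDiffOn ℝ ∞ (fun y => (Matrix.of fun i j => m i j y).det) V := by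
  simp only [Matrix.det_apply, Matrix.of_apply]
  refine ContDiffOn.sum fun σ _ => ?_
  refine ContDiffOn.const_smul _ (contDiffOn_prod fun i _ => h _ _)

namespace LorentzOn

variable {g : Tensor2 ℝ} {U : Set Coord} {y : Coord}

lemma mono (hg : LorentzOn g U) {V : Set Coord} (h : V ⊆ U) : LorentzOn g V :=
  ⟨fun i j => (hg.smooth i j).mono h, fun y hy => hg.symm y (h hy), fun y hy => hg.lorentz y (h hy)⟩

lemma det_neg (hg : LorentzOn g U) (hy : y ∈ U) : (metricMatrix g y).det < 0 := by
  obtain ⟨P, hP, h⟩ := hg.lorentz y hy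
  rw [h, Matrix.det_mul, Matrix.det_mul, Matrix.det_transpose, Matrix.det_diagonal]
  have : 0 < P.det * P.det := mul_self_pos.2 hP
  simp only [Fin.prod_univ_four, Matrix.cons_val]
  linarith

lemma isUnit_det (hg : LorentzOn g U) (hy : y ∈ U) : IsUnit (metricMatrix g y).det :=
  (hg.det_neg hy).ne.isUnit

lemma ginv_symm (hg : LorentzOn g U) (hy : y ∈ U) (i j : Fin 4) : ginv g i j y = ginv g j i y := by
  have : (metricMatrix g y).transpose = metricMatrix g y := by
    ext i j; exact hg.symm y hy j i
  have h2 := congrFun (congrFun (Matrix.transpose_nonsing_inv (metricMatrix g y)) j) i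
  rw [this] at h2
  simpa [ginv] using h2

lemma sum_g_ginv (hg : LorentzOn g U) (hy : y ∈ U) (i j : Fin 4) :
    ∑ k, g i k y * ginv g k j y = if i = j then 1 else 0 := by
  have := congrFun (congrFun (Matrix.mul_nonsing_inv (metricMatrix g y) (hg.isUnit_det hy)) i) j
  simpa [Matrix.mul_apply, Matrix.one_apply, metricMatrix, ginv] using this

lemma sum_ginv_g (hg : LorentzOn g U) (hy : y ∈ U) (i j : Fin 4) :
    ∑ k, ginv g i k y * g k j y = if i = j then 1 else 0 := by
  have := congrFun (congrFun (Matrix.nonsing_inv_mul (metricMatrix g y) (hg.isUnit_det hy)) i) j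
  simpa [Matrix.mul_apply, Matrix.one_apply, metricMatrix, ginv] using this

lemma contDiffOn_ginv (hg : LorentzOn g U) (i j : Fin 4) : ContDiffOn ℝ ∞ (ginv g i j) U := by
  have hdet : ContDiffOn ℝ ∞ (fun y => (metricMatrix g y).det) U := contDiffOn_det hg.smooth
  have hadj : ContDiffOn ℝ ∞ (fun y => (metricMatrix g y).adjugate i j) U := by
    simp only [Matrix.adjugate_apply]
    have : ∀ k l, ContDiffOn ℝ ∞
        (fun y => (metricMatrix g y).updateRow j (Pi.single i 1) k l) U := by
      intro k l
      by_cases hk : k = j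
      · subst hk; simp only [Matrix.updateRow_self]; exact contDiffOn_const
      · simp only [Matrix.updateRow_ne hk]; exact hg.smooth k l
    exact contDiffOn_det this
  refine ((hdet.inv fun y hy => (hg.det_neg hy).ne).mul hadj).congr fun y hy => ?_
  simp [ginv, Matrix.inv_def, Ring.inverse_eq_inv']

end LorentzOn

/-! ### The Levi-Civita connection -/

namespace LorentzOn

variable {g : Tensor2 ℝ} {U : Set Coord} {y : Coord}

lemma contDiffOn_christoffel (hg : LorentzOn g U) (hU : IsOpen U) (k i j : Fin 4) :
    ContDiffOn ℝ ∞ (christoffel g k i j) U := by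
  refine contDiffOn_const.mul (ContDiffOn.sum fun l _ => (hg.contDiffOn_ginv k l).mul ?_)
  exact ((contDiffOn_pd hU (hg.smooth _ _) _).add (contDiffOn_pd hU (hg.smooth _ _) _)).sub
    (contDiffOn_pd hU (hg.smooth _ _) _)

lemma pd_g_symm (hg : LorentzOn g U) (hU : IsOpen U) (hy : y ∈ U) (i j k : Fin 4) :
    pd i (g j k) y = pd i (g k j) y :=
  pd_congr hU hy (fun z hz => hg.symm z hz j k) i

lemma christoffel_symm (hg : LorentzOn g U) (hU : IsOpen U) (hy : y ∈ U) (k i j : Fin 4) :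
    christoffel g k i j y = christoffel g k j i y := by
  simp only [christoffel]
  congr 1
  refine Finset.sum_congr rfl fun l _ => ?_
  rw [hg.pd_g_symm hU hy l i j, hg.pd_g_symm hU hy i l j, hg.pd_g_symm hU hy j i l]
  rw [hg.pd_g_symm hU hy l j i, hg.pd_g_symm hU hy l i j]
  ring

lemma christoffel_lower (hg : LorentzOn g U) (hy : y ∈ U) (k i j : Fin 4) :
    ∑ l, g k l y * christoffel g l i j y
      = 1 / 2 * (pd i (g k j) y + pd j (g i k) y - pd k (g i j) y) := by
  have : ∀ l, g k l y * christoffel g l i j y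
      = ∑ m, g k l y * ginv g l m y *
        (1 / 2 * (pd i (g m j) y + pd j (g i m) y - pd m (g i j) y)) := by
    intro l
    simp only [christoffel, Finset.mul_sum]
    exact Finset.sum_congr rfl fun m _ => by ring
  simp only [this]
  rw [Finset.sum_comm]
  simp only [← Finset.sum_mul, hg.sum_g_ginv hy]
  simp

/-- Metric compatibility of the Levi-Civita connection. -/
lemma pd_metric (hg : LorentzOn g U) (hU : IsOpen U) (hy : y ∈ U) (m j k : Fin 4) :
    pd m (g j k) y = ∑ l, (christoffel g l m j y * g l k y + g j l y * christoffel g l m k y) := by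
  have h1 := hg.christoffel_lower hy j m k
  have h2 := hg.christoffel_lower hy k m j
  rw [Finset.sum_add_distrib, h1]
  have : ∑ l, christoffel g l m j y * g l k y = ∑ l, g k l y * christoffel g l m j y :=
    Finset.sum_congr rfl fun l _ => by rw [hg.symm y hy l k]; ring
  rw [this, h2, hg.pd_g_symm hU hy m k j, hg.pd_g_symm hU hy k m j, hg.pd_g_symm hU hy j m k]
  rw [hg.pd_g_symm hU hy k j m]
  ring

/-- The inverse metric is parallel. -/
lemma pd_ginv (hg : LorentzOn g U) (hU : IsOpen U) (hy : y ∈ U) (m i j : Fin 4) :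
    pd m (ginv g i j) y
      = - ∑ l, (christoffel g i m l y * ginv g l j y + ginv g i l y * christoffel g j m l y) := by
  have hd : ∀ i j, DifferentiableAt ℝ (ginv g i j) y := fun i j =>
    differentiableAt_of_smooth hU (hg.contDiffOn_ginv i j) hy
  have hd' : ∀ i j, DifferentiableAt ℝ (g i j) y := fun i j =>
    differentiableAt_of_smooth hU (hg.smooth i j) hy
  -- the derivative of `g⁻¹ g = 1`, as an identity of matrices
  let dH : Matrix (Fin 4) (Fin 4) ℝ := Matrix.of fun i j => pd m (ginv g i j) y
  let dG : Matrix (Fin 4) (Fin 4) ℝ := Matrix.of fun i j => pd m (g i j) y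
  let Γ : Matrix (Fin 4) (Fin 4) ℝ := Matrix.of fun i j => christoffel g i m j y
  let G := metricMatrix g y
  have h1 : dH * G + G⁻¹ * dG = 0 := by
    ext i j
    have : pd m (fun z => ∑ k, ginv g i k z * g k j z) y = 0 := by
      rw [pd_congr hU hy (fun z hz => hg.sum_ginv_g hz i j), pd_const]
    rw [pd_sum_mul (fun b => hd i b) (fun b => hd' b j), Finset.sum_add_distrib] at this
    simp only [Matrix.add_apply, Matrix.mul_apply, Matrix.zero_apply]
    exact this
  have h2 : dG = Γ.transpose * G + G * Γ := by
    ext i j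
    have := hg.pd_metric hU hy m i j
    rw [Finset.sum_add_distrib] at this
    simp only [Matrix.add_apply, Matrix.mul_apply, Matrix.transpose_apply]
    exact this
  have hG : G * G⁻¹ = 1 := Matrix.mul_nonsing_inv G (hg.isUnit_det hy)
  have hG' : G⁻¹ * G = 1 := Matrix.nonsing_inv_mul G (hg.isUnit_det hy)
  have h3 : dH = - (Γ * G⁻¹ + G⁻¹ * Γ.transpose) := by
    have : dH * G * G⁻¹ = - (G⁻¹ * dG) * G⁻¹ := by rw [eq_neg_of_add_eq_zero_left h1]
    rw [Matrix.mul_assoc, hG, Matrix.mul_one, h2] at this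
    rw [this, Matrix.mul_add, ← Matrix.mul_assoc, ← Matrix.mul_assoc, hG', Matrix.one_mul,
      neg_mul, Matrix.add_mul, Matrix.mul_assoc, Matrix.mul_assoc, hG]
    simp [add_comm]
  have := congrFun (congrFun h3 i) j
  simp only [Matrix.neg_apply, Matrix.add_apply, Matrix.mul_apply, Matrix.transpose_apply] at this
  rw [Finset.sum_add_distrib]
  exact this

end LorentzOn

/-! ### Scalar products at a point -/

section Pointwise

variable {g : Tensor2 ℝ} {U : Set Coord} {y : Coord}

/-- The scalar product of two covectors at the point `y`. -/
def dot (g : Tensor2 ℝ) (y : Coord) (v w : Fin 4 → ℝ) : ℝ :=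
  ∑ i, ∑ j, ginv g i j y * v i * w j

/-- The contravariant components at the point `y` of a covector. -/
def sharp (g : Tensor2 ℝ) (y : Coord) (v : Fin 4 → ℝ) (i : Fin 4) : ℝ :=
  ∑ j, ginv g i j y * v j

lemma inner1_eq_dot (v w : Tensor1 ℝ) :
    inner1 g v w y = dot g y (fun i => v i y) (fun i => w i y) := rfl

lemma up_eq_sharp (v : Tensor1 ℝ) (i : Fin 4) : up g v i y = sharp g y (fun j => v j y) i := rfl

lemma dot_eq_sum_mul_sharp (v w : Fin 4 → ℝ) : dot g y v w = ∑ i, v i * sharp g y w i := by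
  simp only [dot, sharp, Finset.mul_sum]
  exact Finset.sum_congr rfl fun i _ => Finset.sum_congr rfl fun j _ => by ring

lemma LorentzOn.dot_comm (hg : LorentzOn g U) (hy : y ∈ U) (v w : Fin 4 → ℝ) :
    dot g y v w = dot g y w v := by
  simp only [dot]
  rw [Finset.sum_comm]
  exact Finset.sum_congr rfl fun i _ => Finset.sum_congr rfl fun j _ => by
    rw [hg.ginv_symm hy]; ring

lemma dot_add_left (u v w : Fin 4 → ℝ) : dot g y (u + v) w = dot g y u w + dot g y v w := by
  simp only [dot, ← Finset.sum_add_distrib, Pi.add_apply]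
  exact Finset.sum_congr rfl fun i _ => Finset.sum_congr rfl fun j _ => by ring

lemma dot_smul_left (c : ℝ) (v w : Fin 4 → ℝ) : dot g y (c • v) w = c * dot g y v w := by
  simp only [dot, Finset.mul_sum, Pi.smul_apply, smul_eq_mul]
  exact Finset.sum_congr rfl fun i _ => Finset.sum_congr rfl fun j _ => by ring

lemma dot_add_right (u v w : Fin 4 → ℝ) : dot g y u (v + w) = dot g y u v + dot g y u w := by
  simp only [dot, ← Finset.sum_add_distrib, Pi.add_apply]
  exact Finset.sum_congr rfl fun i _ => Finset.sum_congr rfl fun j _ => by ring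

lemma dot_smul_right (c : ℝ) (v w : Fin 4 → ℝ) : dot g y v (c • w) = c * dot g y v w := by
  simp only [dot, Finset.mul_sum, Pi.smul_apply, smul_eq_mul]
  exact Finset.sum_congr rfl fun i _ => Finset.sum_congr rfl fun j _ => by ring

lemma dot_neg_left (v w : Fin 4 → ℝ) : dot g y (-v) w = - dot g y v w := by
  simpa using dot_smul_left (g := g) (y := y) (-1) v w

lemma dot_neg_right (v w : Fin 4 → ℝ) : dot g y v (-w) = - dot g y v w := by
  simpa using dot_smul_right (g := g) (y := y) (-1) v w

lemma dot_sub_left (u v w : Fin 4 → ℝ) : dot g y (u - v) w = dot g y u w - dot g y v w := by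
  rw [sub_eq_add_neg, dot_add_left, dot_neg_left, sub_eq_add_neg]

lemma dot_sub_right (u v w : Fin 4 → ℝ) : dot g y u (v - w) = dot g y u v - dot g y u w := by
  rw [sub_eq_add_neg, dot_add_right, dot_neg_right, sub_eq_add_neg]

lemma LorentzOn.sum_g_sharp (hg : LorentzOn g U) (hy : y ∈ U) (v : Fin 4 → ℝ) (i : Fin 4) :
    ∑ j, g i j y * sharp g y v j = v i := by
  simp only [sharp, Finset.mul_sum]
  rw [Finset.sum_comm]
  simp only [← mul_assoc, ← Finset.sum_mul, hg.sum_g_ginv hy]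
  simp

/-- A null covector that is orthogonal to a time-like one vanishes. -/
lemma LorentzOn.eq_zero_of_null (hg : LorentzOn g U) (hy : y ∈ U) {v x : Fin 4 → ℝ}
    (hv : dot g y v v = 0) (hx : dot g y x x < 0) (hvx : dot g y v x = 0) : v = 0 := by
  obtain ⟨P, hP, h⟩ := hg.lorentz y hy
  have hPu : IsUnit P.det := hP.isUnit
  -- in the components `Q = P⁻¹ᵀ` the scalar product has the standard form
  set Q : Matrix (Fin 4) (Fin 4) ℝ := P⁻¹.transpose with hQ
  have hinv : (metricMatrix g y)⁻¹ = Q.transpose * Matrix.diagonal ![-1, 1, 1, 1] * Q := by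
    apply Matrix.inv_eq_left_inv
    rw [h, hQ, Matrix.transpose_transpose]
    have h1 : P⁻¹.transpose * P.transpose = 1 := by
      rw [← Matrix.transpose_mul, Matrix.mul_nonsing_inv P hPu, Matrix.transpose_one]
    have h2 : (Matrix.diagonal ![-1, 1, 1, 1] : Matrix (Fin 4) (Fin 4) ℝ)
        * Matrix.diagonal ![-1, 1, 1, 1] = 1 := by
      rw [Matrix.diagonal_mul_diagonal, ← Matrix.diagonal_one]
      congr 1; ext i; fin_cases i <;> simp
    calc _ = P⁻¹ * Matrix.diagonal ![-1, 1, 1, 1] * (P⁻¹.transpose * P.transpose)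
          * Matrix.diagonal ![-1, 1, 1, 1] * P := by simp only [Matrix.mul_assoc]
      _ = P⁻¹ * (Matrix.diagonal ![-1, 1, 1, 1] * Matrix.diagonal ![-1, 1, 1, 1]) * P := by
          rw [h1, Matrix.mul_one]; simp only [Matrix.mul_assoc]
      _ = 1 := by rw [h2, Matrix.mul_one, Matrix.nonsing_inv_mul P hPu]
  have hdot : ∀ v w : Fin 4 → ℝ, dot g y v w = - (Q.mulVec v 0 * Q.mulVec w 0)
      + Q.mulVec v 1 * Q.mulVec w 1 + Q.mulVec v 2 * Q.mulVec w 2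
      + Q.mulVec v 3 * Q.mulVec w 3 := by
    intro v w
    have hent : ∀ i j, ginv g i j y
        = - (Q 0 i * Q 0 j) + Q 1 i * Q 1 j + Q 2 i * Q 2 j + Q 3 i * Q 3 j := by
      intro i j
      rw [ginv, hinv, Matrix.mul_apply]
      simp [Fin.sum_univ_four, Matrix.mul_diagonal]
    simp only [dot, hent, Matrix.mulVec, dotProduct, Fin.sum_univ_four]
    ring
  rw [hdot] at hv hx hvx
  have hdetQ : IsUnit Q := by
    rw [Matrix.isUnit_iff_isUnit_det, hQ, Matrix.det_transpose]
    exact Matrix.isUnit_nonsing_inv_det P hPu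
  have hQv : Q.mulVec v = 0 := by
    set p := Q.mulVec v
    set q := Q.mulVec x
    -- the Cauchy-Schwarz inequality for the space-like components
    have hcs : (p 1 * q 1 + p 2 * q 2 + p 3 * q 3) ^ 2
        ≤ (p 1 ^ 2 + p 2 ^ 2 + p 3 ^ 2) * (q 1 ^ 2 + q 2 ^ 2 + q 3 ^ 2) := by
      nlinarith [sq_nonneg (p 1 * q 2 - p 2 * q 1), sq_nonneg (p 1 * q 3 - p 3 * q 1),
        sq_nonneg (p 2 * q 3 - p 3 * q 2)]
    have e1 : p 1 * q 1 + p 2 * q 2 + p 3 * q 3 = p 0 * q 0 := by linarith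
    have e2 : p 1 ^ 2 + p 2 ^ 2 + p 3 ^ 2 = p 0 ^ 2 := by linarith
    rw [e1, e2] at hcs
    have h0 : p 0 = 0 := by
      by_contra h0
      have : 0 < p 0 ^ 2 := by positivity
      nlinarith
    rw [h0] at e2
    have h1 : p 1 = 0 := by nlinarith [sq_nonneg (p 1), sq_nonneg (p 2), sq_nonneg (p 3)]
    have h2 : p 2 = 0 := by nlinarith [sq_nonneg (p 1), sq_nonneg (p 2), sq_nonneg (p 3)]
    have h3 : p 3 = 0 := by nlinarith [sq_nonneg (p 1), sq_nonneg (p 2), sq_nonneg (p 3)]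
    ext i; fin_cases i <;> simp [h0, h1, h2, h3]
  exact Matrix.mulVec_injective_of_isUnit hdetQ (by simpa using hQv)

end Pointwise

/-! ### Null frames and their connection forms -/

section NullFrames

variable {g : Tensor2 ℝ} {V : Set Coord} {y : Coord}

lemma contDiffOn_inner1 (hg : LorentzOn g V) {v w : Tensor1 ℝ}
    (hv : ∀ i, ContDiffOn ℝ ∞ (v i) V) (hw : ∀ i, ContDiffOn ℝ ∞ (w i) V) :
    ContDiffOn ℝ ∞ (inner1 g v w) V :=
  ContDiffOn.sum fun i _ => ContDiffOn.sum fun j _ =>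
    ((hg.contDiffOn_ginv i j).mul (hv i)).mul (hw j)

lemma contDiffOn_nabla1 (hg : LorentzOn g V) (hV : IsOpen V) {v : Tensor1 ℝ}
    (hv : ∀ i, ContDiffOn ℝ ∞ (v i) V) (i j : Fin 4) :
    ContDiffOn ℝ ∞ (nabla1 g v i j) V :=
  (contDiffOn_pd hV (hv j) i).sub
    (ContDiffOn.sum fun k _ => (hg.contDiffOn_christoffel hV k i j).mul (hv k))

/-- The Leibniz rule for the scalar product of covectors. -/
lemma pd_inner1 (hg : LorentzOn g V) (hV : IsOpen V) (hy : y ∈ V) {v w : Tensor1 ℝ}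
    (hv : ∀ i, ContDiffOn ℝ ∞ (v i) V) (hw : ∀ i, ContDiffOn ℝ ∞ (w i) V) (m : Fin 4) :
    pd m (inner1 g v w) y = inner1 g (fun j => nabla1 g v m j) w y
      + inner1 g v (fun j => nabla1 g w m j) y := by
  have dg : ∀ i j, DifferentiableAt ℝ (ginv g i j) y := fun i j =>
    differentiableAt_of_smooth hV (hg.contDiffOn_ginv i j) hy
  have dv : ∀ i, DifferentiableAt ℝ (v i) y := fun i => differentiableAt_of_smooth hV (hv i) hy
  have dw : ∀ i, DifferentiableAt ℝ (w i) y := fun i => differentiableAt_of_smooth hV (hw i) hy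
  have h0 : pd m (inner1 g v w) y = ∑ i, ∑ j, ((pd m (ginv g i j) y * v i y
      + ginv g i j y * pd m (v i) y) * w j y + ginv g i j y * v i y * pd m (w j) y) := by
    have : inner1 g v w = fun z => ∑ i, ∑ j, ginv g i j z * v i z * w j z := rfl
    rw [this, pd_sum (f := fun i z => ∑ j, ginv g i j z * v i z * w j z)
      fun i => DifferentiableAt.fun_sum fun j _ => ((dg i j).fun_mul (dv i)).fun_mul (dw j)]
    refine Finset.sum_congr rfl fun i _ => ?_
    rw [pd_sum (f := fun j z => ginv g i j z * v i z * w j z)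
      fun j => ((dg i j).fun_mul (dv i)).fun_mul (dw j)]
    refine Finset.sum_congr rfl fun j _ => ?_
    rw [pd_mul (f := fun z => ginv g i j z * v i z) ((dg i j).mul (dv i)) (dw j),
      pd_mul (dg i j) (dv i)]
  rw [h0]
  simp only [hg.pd_ginv hV hy, inner1, nabla1, Fin.sum_univ_four]
  ring

/-- The Gram matrix of a real null frame `(ℓ, e, f, n)`, with `(ℓ, n) = -1`. -/
def nullGram : Matrix (Fin 4) (Fin 4) ℝ :=
  !![0, 0, 0, -1; 0, 1, 0, 0; 0, 0, 1, 0; -1, 0, 0, 0]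

/-- The frame of covectors dual to the null frame `(ℓ, e, f, n)`: it is `(-n, e, f, -ℓ)`. -/
def coframe (E : Fin 4 → Tensor1 ℝ) : Fin 4 → Tensor1 ℝ :=
  ![fun i y => - E 3 i y, E 1, E 2, fun i y => - E 0 i y]

/-- The 1-forms `E = (ℓ, e, f, n)` are a smooth null frame on `V`. -/
structure IsNullFrame (g : Tensor2 ℝ) (V : Set Coord) (E : Fin 4 → Tensor1 ℝ) : Prop where
  smooth : ∀ a i, ContDiffOn ℝ ∞ (E a i) V
  gram : ∀ y ∈ V, ∀ a b, inner1 g (E a) (E b) y = nullGram a b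

/-- The connection forms of a frame: `∇_i E_a = ∑ b, connForm g E a b i • E_b`. -/
def connForm (g : Tensor2 ℝ) (E : Fin 4 → Tensor1 ℝ) (a b i : Fin 4) (y : Coord) : ℝ :=
  inner1 g (fun j => nabla1 g (E a) i j) (coframe E b) y

/-- The curvature forms of a frame, `dω_{ab} - ω_{ac} ∧ ω_{cb}` in terms of the connection forms. -/
def curvForm (g : Tensor2 ℝ) (E : Fin 4 → Tensor1 ℝ) (a b m i : Fin 4) (y : Coord) : ℝ :=
  pd m (connForm g E a b i) y - pd i (connForm g E a b m) y
    + ∑ c, (connForm g E a c i y * connForm g E c b m y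
      - connForm g E a c m y * connForm g E c b i y)

namespace IsNullFrame

variable {E : Fin 4 → Tensor1 ℝ}

lemma smooth_coframe (hE : IsNullFrame g V E) (b i : Fin 4) :
    ContDiffOn ℝ ∞ (coframe E b i) V := by
  fin_cases b
  · exact (hE.smooth 3 i).neg
  · exact hE.smooth 1 i
  · exact hE.smooth 2 i
  · exact (hE.smooth 0 i).neg

lemma duality (hE : IsNullFrame g V E) (hy : y ∈ V) (a b : Fin 4) :
    inner1 g (E a) (coframe E b) y = if a = b then 1 else 0 := by
  have hneg : ∀ c, inner1 g (E a) (fun i y => - E c i y) y = - nullGram a c := fun c => by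
    rw [← hE.gram y hy a c]; exact dot_neg_right _ _
  fin_cases b
  · refine (hneg 3).trans ?_; fin_cases a <;> simp [nullGram]
  · refine (hE.gram y hy a 1).trans ?_; fin_cases a <;> simp [nullGram]
  · refine (hE.gram y hy a 2).trans ?_; fin_cases a <;> simp [nullGram]
  · refine (hneg 0).trans ?_; fin_cases a <;> simp [nullGram]

lemma completeness (hE : IsNullFrame g V E) (hy : y ∈ V) (i j : Fin 4) :
    ∑ b, up g (coframe E b) i y * E b j y = if i = j then 1 else 0 := by
  let M : Matrix (Fin 4) (Fin 4) ℝ := Matrix.of fun a i => E a i y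
  let N : Matrix (Fin 4) (Fin 4) ℝ := Matrix.of fun i b => up g (coframe E b) i y
  have h1 : M * N = 1 := by
    ext a b
    have := hE.duality hy a b
    rw [inner1_eq_dot, dot_eq_sum_mul_sharp] at this
    rw [Matrix.mul_apply, Matrix.one_apply]
    exact this
  have h2 : N * M = 1 := mul_eq_one_comm.1 h1
  have := congrFun (congrFun h2 i) j
  rw [Matrix.mul_apply, Matrix.one_apply] at this
  exact this

/-- The expansion of a covector in a null frame. -/
lemma expand (hE : IsNullFrame g V E) (hy : y ∈ V) (v : Fin 4 → ℝ) (j : Fin 4) :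
    v j = ∑ b, dot g y v (fun i => coframe E b i y) * E b j y := by
  have : ∀ b, dot g y v (fun i => coframe E b i y) * E b j y
      = ∑ i, v i * (up g (coframe E b) i y * E b j y) := by
    intro b
    rw [dot_eq_sum_mul_sharp, Finset.sum_mul]
    exact Finset.sum_congr rfl fun i _ => by rw [up_eq_sharp]; ring
  simp only [this]
  rw [Finset.sum_comm]
  simp only [← Finset.mul_sum, hE.completeness hy]
  simp

/-- The coefficients of an expansion in a null frame are unique. -/
lemma coeff_ext (hE : IsNullFrame g V E) (hy : y ∈ V) {c d : Fin 4 → ℝ}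
    (h : ∀ j, ∑ b, c b * E b j y = ∑ b, d b * E b j y) (b : Fin 4) : c b = d b := by
  have key : ∀ c : Fin 4 → ℝ, ∑ j, (∑ a, c a * E a j y) * up g (coframe E b) j y = c b := by
    intro c
    simp only [Finset.sum_mul]
    rw [Finset.sum_comm]
    have : ∀ a, ∑ j, c a * E a j y * up g (coframe E b) j y = c a * if a = b then 1 else 0 := by
      intro a
      rw [← hE.duality hy a b, inner1_eq_dot, dot_eq_sum_mul_sharp, Finset.mul_sum]
      exact Finset.sum_congr rfl fun j _ => by rw [up_eq_sharp]; ring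
    simp only [this]
    simp
  rw [← key c, ← key d]
  simp only [h]

lemma metric_eq (hE : IsNullFrame g V E) (hg : LorentzOn g V) (hy : y ∈ V) (i j : Fin 4) :
    g i j y = ∑ b, coframe E b i y * E b j y := by
  have h := hE.expand hy (fun k => g i k y) j
  rw [h]
  refine Finset.sum_congr rfl fun b _ => ?_
  rw [dot_eq_sum_mul_sharp, hg.sum_g_sharp hy]

lemma smooth_connForm (hE : IsNullFrame g V E) (hg : LorentzOn g V) (hV : IsOpen V)
    (a b i : Fin 4) : ContDiffOn ℝ ∞ (connForm g E a b i) V :=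
  contDiffOn_inner1 hg (fun j => contDiffOn_nabla1 hg hV (hE.smooth a) i j) (hE.smooth_coframe b)

lemma nabla_frame (hE : IsNullFrame g V E) (hy : y ∈ V) (a i j : Fin 4) :
    nabla1 g (E a) i j y = ∑ b, connForm g E a b i y * E b j y :=
  hE.expand hy (fun j => nabla1 g (E a) i j y) j

lemma pd_frame (hE : IsNullFrame g V E) (hy : y ∈ V) (a i j : Fin 4) :
    pd i (E a j) y = ∑ b, connForm g E a b i y * E b j y
      + ∑ k, christoffel g k i j y * E a k y := by
  rw [← hE.nabla_frame hy, nabla1]; ring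

lemma inner1_nabla_antisymm (hE : IsNullFrame g V E) (hg : LorentzOn g V) (hV : IsOpen V)
    (hy : y ∈ V) (a b i : Fin 4) :
    inner1 g (fun j => nabla1 g (E a) i j) (E b) y
      = - inner1 g (fun j => nabla1 g (E b) i j) (E a) y := by
  have h := pd_inner1 hg hV hy (hE.smooth a) (hE.smooth b) i
  rw [pd_congr hV hy (fun z hz => hE.gram z hz a b), pd_const] at h
  have hc : inner1 g (E a) (fun j => nabla1 g (E b) i j) y
      = inner1 g (fun j => nabla1 g (E b) i j) (E a) y := hg.dot_comm hy _ _
  linarith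

/-- The connection forms of a null frame take values in the Lie algebra of the Lorentz group. -/
lemma connForm_relations (hE : IsNullFrame g V E) (hg : LorentzOn g V) (hV : IsOpen V)
    (hy : y ∈ V) :
    (∀ i, connForm g E 0 3 i y = 0) ∧ (∀ i, connForm g E 1 1 i y = 0) ∧
    (∀ i, connForm g E 2 2 i y = 0) ∧ (∀ i, connForm g E 3 0 i y = 0) ∧
    (∀ i, connForm g E 1 3 i y = connForm g E 0 1 i y) ∧
    (∀ i, connForm g E 2 3 i y = connForm g E 0 2 i y) ∧
    (∀ i, connForm g E 2 1 i y = - connForm g E 1 2 i y) ∧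
    (∀ i, connForm g E 3 1 i y = connForm g E 1 0 i y) ∧
    (∀ i, connForm g E 3 2 i y = connForm g E 2 0 i y) ∧
    (∀ i, connForm g E 3 3 i y = - connForm g E 0 0 i y) := by
  simp only [← forall_and]
  intro i
  have h := hE.inner1_nabla_antisymm hg hV hy (i := i)
  have h0 : ∀ a, connForm g E a 0 i y = - inner1 g (fun j => nabla1 g (E a) i j) (E 3) y :=
    fun a => dot_neg_right _ _
  have h1 : ∀ a, connForm g E a 1 i y = inner1 g (fun j => nabla1 g (E a) i j) (E 1) y :=
    fun a => rfl
  have h2 : ∀ a, connForm g E a 2 i y = inner1 g (fun j => nabla1 g (E a) i j) (E 2) y :=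
    fun a => rfl
  have h3 : ∀ a, connForm g E a 3 i y = - inner1 g (fun j => nabla1 g (E a) i j) (E 0) y :=
    fun a => dot_neg_right _ _
  simp only [h0, h1, h2, h3]
  have h00 := h 0 0
  have h11 := h 1 1
  have h22 := h 2 2
  have h33 := h 3 3
  have h01 := h 0 1
  have h02 := h 0 2
  have h03 := h 0 3
  have h12 := h 1 2
  have h13 := h 1 3
  have h23 := h 2 3
  refine ⟨?_, ?_, ?_, ?_, ?_, ?_, ?_, ?_, ?_, ?_⟩ <;> linarith

/-- The Ricci identity for the covectors of a frame. -/
lemma ricci_identity (hE : IsNullFrame g V E) (hg : LorentzOn g V) (hV : IsOpen V) (hy : y ∈ V)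
    (a j m i : Fin 4) :
    ∑ b, curvForm g E a b m i y * E b j y + ∑ k, riemannUp g k j m i y * E a k y = 0 := by
  have dA : ∀ a b i, DifferentiableAt ℝ (connForm g E a b i) y := fun a b i =>
    differentiableAt_of_smooth hV (hE.smooth_connForm hg hV a b i) hy
  have dE : ∀ a i, DifferentiableAt ℝ (E a i) y := fun a i =>
    differentiableAt_of_smooth hV (hE.smooth a i) hy
  have dΓ : ∀ k i j, DifferentiableAt ℝ (christoffel g k i j) y := fun k i j =>
    differentiableAt_of_smooth hV (hg.contDiffOn_christoffel hV k i j) hy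
  have h2 : ∀ m i, pd m (pd i (E a j)) y
      = ∑ b, (pd m (connForm g E a b i) y * E b j y + connForm g E a b i y * pd m (E b j) y)
      + ∑ k, (pd m (christoffel g k i j) y * E a k y
        + christoffel g k i j y * pd m (E a k) y) := by
    intro m i
    rw [pd_congr hV hy (fun z hz => hE.pd_frame hz a i j), pd_add
      (DifferentiableAt.fun_sum fun b _ => (dA a b i).fun_mul (dE b j))
      (DifferentiableAt.fun_sum fun k _ => (dΓ k i j).fun_mul (dE a k)),
      pd_sum_mul (fun b => dA a b i) (fun b => dE b j),
      pd_sum_mul (fun k => dΓ k i j) (fun k => dE a k)]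
  have hc := pd_comm hV (hE.smooth a j) hy m i
  rw [h2, h2] at hc
  simp only [hE.pd_frame hy] at hc
  simp only [curvForm, riemannUp]
  simp only [Fin.sum_univ_four] at hc ⊢
  linear_combination hc

end IsNullFrame
end NullFrames

/-! ### Curvature of a type N Einstein metric in a null frame -/

section Curvature

variable {g : Tensor2 ℝ} {V : Set Coord} {y : Coord} {E : Fin 4 → Tensor1 ℝ}

/-- The second Bianchi identity for the curvature forms of a frame. -/
lemma IsNullFrame.bianchi (hE : IsNullFrame g V E) (hg : LorentzOn g V) (hV : IsOpen V)
    (hy : y ∈ V) (a b k m i : Fin 4) :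
    pd k (curvForm g E a b m i) y + pd m (curvForm g E a b i k) y + pd i (curvForm g E a b k m) y
      = ∑ c, (connForm g E a c k y * curvForm g E c b m i y
          - curvForm g E a c m i y * connForm g E c b k y)
        + ∑ c, (connForm g E a c m y * curvForm g E c b i k y
          - curvForm g E a c i k y * connForm g E c b m y)
        + ∑ c, (connForm g E a c i y * curvForm g E c b k m y
          - curvForm g E a c k m y * connForm g E c b i y) := by
  have sA : ∀ a b i, ContDiffOn ℝ ∞ (connForm g E a b i) V := fun a b i =>
    hE.smooth_connForm hg hV a b i
  have dA : ∀ a b i, DifferentiableAt ℝ (connForm g E a b i) y := fun a b i =>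
    differentiableAt_of_smooth hV (sA a b i) hy
  have ddA : ∀ a b m i, DifferentiableAt ℝ (pd m (connForm g E a b i)) y := fun a b m i =>
    differentiableAt_of_smooth hV (contDiffOn_pd hV (sA a b i) m) hy
  have key : ∀ k m i, pd k (curvForm g E a b m i) y
      = pd k (pd m (connForm g E a b i)) y - pd k (pd i (connForm g E a b m)) y
      + (∑ c, (pd k (connForm g E a c i) y * connForm g E c b m y
          + connForm g E a c i y * pd k (connForm g E c b m) y)
        - ∑ c, (pd k (connForm g E a c m) y * connForm g E c b i y
          + connForm g E a c m y * pd k (connForm g E c b i) y)) := by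
    intro k m i
    have h : curvForm g E a b m i = fun z => (pd m (connForm g E a b i) z
        - pd i (connForm g E a b m) z) + ((∑ c, connForm g E a c i z * connForm g E c b m z)
          - ∑ c, connForm g E a c m z * connForm g E c b i z) := by
      funext z; simp only [curvForm, Finset.sum_sub_distrib]
    have d1 : ∀ m i, DifferentiableAt ℝ
        (fun z => ∑ c, connForm g E a c i z * connForm g E c b m z) y := fun m i =>
      DifferentiableAt.fun_sum fun c _ => (dA a c i).fun_mul (dA c b m)
    rw [h, pd_add ((ddA a b m i).fun_sub (ddA a b i m)) ((d1 m i).fun_sub (d1 i m)),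
      pd_sub (ddA a b m i) (ddA a b i m), pd_sub (d1 m i) (d1 i m),
      pd_sum_mul (fun c => dA a c i) (fun c => dA c b m),
      pd_sum_mul (fun c => dA a c m) (fun c => dA c b i)]
  rw [key, key, key, pd_comm hV (sA a b i) hy m k, pd_comm hV (sA a b k) hy i m,
    pd_comm hV (sA a b m) hy k i]
  simp only [curvForm, Fin.sum_univ_four]
  ring

/-- The exterior derivatives of the frame are given by the connection forms: the connection is free
of torsion. -/
lemma IsNullFrame.exists_pd_frame (hE : IsNullFrame g V E) (hg : LorentzOn g V) (hV : IsOpen V)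
    (hy : y ∈ V) : ∃ S : Fin 4 → Fin 4 → Fin 4 → ℝ,
      (∀ a i j, pd i (E a j) y = ∑ b, connForm g E a b i y * E b j y + S a i j) ∧
      ∀ a i j, S a i j = S a j i :=
  ⟨fun a i j => ∑ k, christoffel g k i j y * E a k y, fun a i j => hE.pd_frame hy a i j,
    fun a i j => Finset.sum_congr rfl fun k _ => by rw [hg.christoffel_symm hV hy]⟩

/-- A null frame `(ℓ, e, f, n)` in which the curvature is that of a type N Einstein space with
`Ric = 3 lam g`, and `ℓ ∧ e`, `ℓ ∧ f` are the fundamental 2-form and its dual. -/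
structure IsTypeNFrame (g : Tensor2 ℝ) (V : Set Coord) (E : Fin 4 → Tensor1 ℝ) (lam : ℝ) : Prop
    extends IsNullFrame g V E where
  riemann_eq : ∀ y ∈ V, ∀ i j k l, riemann g i j k l y
    = wedge (E 0) (E 1) i j y * wedge (E 0) (E 1) k l y
      - wedge (E 0) (E 2) i j y * wedge (E 0) (E 2) k l y
      + lam * (g i k y * g j l y - g i l y * g j k y)

variable {lam : ℝ}

lemma sum_wedge_up (u v : Tensor1 ℝ) (w : Tensor1 ℝ) (j : Fin 4) :
    ∑ n, wedge u v n j y * up g w n y = inner1 g u w y * v j y - inner1 g v w y * u j y := by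
  simp only [inner1_eq_dot, dot_eq_sum_mul_sharp, ← up_eq_sharp, Finset.sum_mul,
    ← Finset.sum_sub_distrib, wedge]
  exact Finset.sum_congr rfl fun i _ => by ring

lemma IsTypeNFrame.curvForm_eq (hE : IsTypeNFrame g V E lam) (hg : LorentzOn g V) (hV : IsOpen V)
    (hy : y ∈ V) (a b m i : Fin 4) :
    curvForm g E a b m i y
      = - (nullGram 0 a * (if b = 1 then 1 else 0) - nullGram 1 a * if b = 0 then 1 else 0)
          * wedge (E 0) (E 1) m i y
        + (nullGram 0 a * (if b = 2 then 1 else 0) - nullGram 2 a * if b = 0 then 1 else 0)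
          * wedge (E 0) (E 2) m i y
        - lam * (E a m y * coframe E b i y - E a i y * coframe E b m y) := by
  have hE' := hE.toIsNullFrame
  refine hE'.coeff_ext hy (c := fun b => curvForm g E a b m i y) (d := fun b =>
    - (nullGram 0 a * (if b = 1 then 1 else 0) - nullGram 1 a * if b = 0 then 1 else 0)
          * wedge (E 0) (E 1) m i y
        + (nullGram 0 a * (if b = 2 then 1 else 0) - nullGram 2 a * if b = 0 then 1 else 0)
          * wedge (E 0) (E 2) m i y
        - lam * (E a m y * coframe E b i y - E a i y * coframe E b m y)) (fun j => ?_) b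
  have h1 := hE'.ricci_identity hg hV hy a j m i
  have h2 : ∑ k, riemannUp g k j m i y * E a k y
      = ∑ n, riemann g n j m i y * up g (E a) n y := by
    simp only [riemann, Finset.sum_mul]
    rw [Finset.sum_comm]
    refine Finset.sum_congr rfl fun k _ => ?_
    have := hg.sum_g_sharp hy (fun i => E a i y) k
    rw [← this, Finset.mul_sum]
    refine Finset.sum_congr rfl fun n _ => ?_
    rw [up_eq_sharp, hg.symm y hy]; ring
  have h3 : ∑ n, riemann g n j m i y * up g (E a) n y
      = (∑ n, wedge (E 0) (E 1) n j y * up g (E a) n y) * wedge (E 0) (E 1) m i y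
        - (∑ n, wedge (E 0) (E 2) n j y * up g (E a) n y) * wedge (E 0) (E 2) m i y
        + lam * ((∑ n, g m n y * up g (E a) n y) * g j i y
          - (∑ n, g i n y * up g (E a) n y) * g j m y) := by
    simp only [Finset.sum_mul, ← Finset.sum_sub_distrib, ← Finset.sum_add_distrib, Finset.mul_sum]
    refine Finset.sum_congr rfl fun n _ => ?_
    rw [hE.riemann_eq y hy, hg.symm y hy n m, hg.symm y hy n i]; ring
  have h4 : ∀ m, ∑ n, g m n y * up g (E a) n y = E a m y :=
    fun m => hg.sum_g_sharp hy (fun i => E a i y) m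
  rw [h2, h3, sum_wedge_up, sum_wedge_up, h4, h4, hE.gram y hy, hE.gram y hy, hE.gram y hy,
    hg.symm y hy j i, hg.symm y hy j m, hE'.metric_eq hg hy, hE'.metric_eq hg hy] at h1
  have h5 : ∀ b : Fin 4 → ℝ, ∑ c, b c * E c j y
    = b 0 * E 0 j y + b 1 * E 1 j y + b 2 * E 2 j y + b 3 * E 3 j y := fun b => Fin.sum_univ_four _
  rw [h5] at h1 ⊢
  simp only [Fin.sum_univ_four] at h1 ⊢
  simp
  linear_combination h1

end Curvature

/-! ### Consequences of the Bianchi identity -/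

section Bianchi

variable {g : Tensor2 ℝ} {V : Set Coord} {y : Coord} {E : Fin 4 → Tensor1 ℝ} {lam : ℝ}

/-- The components of the exterior product of three covectors at a point. -/
def wedge3 (u v w : Fin 4 → ℝ) (k m i : Fin 4) : ℝ :=
  u k * (v m * w i - v i * w m) + u m * (v i * w k - v k * w i) + u i * (v k * w m - v m * w k)

/-- The value on three vectors of a tensor with three indices. -/
def eval3 (p q r : Fin 4 → ℝ) (T : Fin 4 → Fin 4 → Fin 4 → ℝ) : ℝ :=
  ∑ k, ∑ m, ∑ i, T k m i * p k * q m * r i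

lemma eval3_wedge3 (p q r u v w : Fin 4 → ℝ) :
    eval3 (sharp g y p) (sharp g y q) (sharp g y r) (wedge3 u v w)
      = dot g y u p * (dot g y v q * dot g y w r - dot g y v r * dot g y w q)
        + dot g y u q * (dot g y v r * dot g y w p - dot g y v p * dot g y w r)
        + dot g y u r * (dot g y v p * dot g y w q - dot g y v q * dot g y w p) := by
  simp only [dot_eq_sum_mul_sharp, eval3, wedge3, Fin.sum_univ_four]
  ring

lemma eval3_add (p q r : Fin 4 → ℝ) (T S : Fin 4 → Fin 4 → Fin 4 → ℝ) :
    eval3 p q r (T + S) = eval3 p q r T + eval3 p q r S := by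
  simp only [eval3, ← Finset.sum_add_distrib, Pi.add_apply]
  exact Finset.sum_congr rfl fun k _ => Finset.sum_congr rfl fun m _ =>
    Finset.sum_congr rfl fun i _ => by ring

lemma eval3_smul (p q r : Fin 4 → ℝ) (c : ℝ) (T : Fin 4 → Fin 4 → Fin 4 → ℝ) :
    eval3 p q r (c • T) = c * eval3 p q r T := by
  simp only [eval3, Finset.mul_sum, Pi.smul_apply, smul_eq_mul]
  exact Finset.sum_congr rfl fun k _ => Finset.sum_congr rfl fun m _ =>
    Finset.sum_congr rfl fun i _ => by ring

lemma eval3_zero (p q r : Fin 4 → ℝ) : eval3 p q r 0 = 0 := by simp [eval3]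

lemma pd_wedge {u v : Tensor1 ℝ} (hu : ∀ i, DifferentiableAt ℝ (u i) y)
    (hv : ∀ i, DifferentiableAt ℝ (v i) y) (k m i : Fin 4) :
    pd k (fun z => wedge u v m i z) y = (pd k (u m) y * v i y + u m y * pd k (v i) y)
      - (pd k (v m) y * u i y + v m y * pd k (u i) y) := by
  simp only [wedge]
  rw [pd_sub ((hu m).fun_mul (hv i)) ((hv m).fun_mul (hu i)), pd_mul (hu m) (hv i),
    pd_mul (hv m) (hu i)]

namespace IsTypeNFrame

/-- The Bianchi identity for the component `ℓ ∧ n` of the curvature. -/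
lemma bianchi_ln (hE : IsTypeNFrame g V E lam) (hg : LorentzOn g V) (hV : IsOpen V)
    (hy : y ∈ V) (k m i : Fin 4) :
    wedge3 (fun i => connForm g E 0 1 i y) (fun i => E 0 i y) (fun i => E 1 i y) k m i
      - wedge3 (fun i => connForm g E 0 2 i y) (fun i => E 0 i y) (fun i => E 2 i y) k m i = 0 := by
  have hE' := hE.toIsNullFrame
  have dE : ∀ a i, DifferentiableAt ℝ (E a i) y := fun a i =>
    differentiableAt_of_smooth hV (hE.smooth a i) hy
  have hF : ∀ m i, ∀ z ∈ V, curvForm g E 0 0 m i z = lam * wedge (E 0) (E 3) m i z := by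
    intro m i z hz
    rw [hE.curvForm_eq hg hV hz]
    simp [nullGram, coframe, wedge]; ring
  have dw : ∀ m i, DifferentiableAt ℝ (fun z => wedge (E 0) (E 3) m i z) y := fun m i =>
    ((dE 0 m).fun_mul (dE 3 i)).fun_sub ((dE 3 m).fun_mul (dE 0 i))
  have h := hE'.bianchi hg hV hy 0 0 k m i
  rw [pd_congr hV hy (hF m i), pd_congr hV hy (hF i k), pd_congr hV hy (hF k m),
    pd_const_mul (dw m i), pd_const_mul (dw i k), pd_const_mul (dw k m),
    pd_wedge (dE 0) (dE 3), pd_wedge (dE 0) (dE 3), pd_wedge (dE 0) (dE 3)] at h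
  obtain ⟨S, hS, hSs⟩ := hE'.exists_pd_frame hg hV hy
  simp only [hS, hE.curvForm_eq hg hV hy, Fin.sum_univ_four] at h
  obtain ⟨c03, -, -, c30, -, -, -, c31, c32, c33⟩ := hE'.connForm_relations hg hV hy
  simp only [c03, c30, c31, c32, c33, hSs _ m k, hSs _ i m, hSs _ k i] at h
  simp [nullGram, coframe, wedge] at h
  simp only [wedge3]
  linear_combination -h

/-- The Bianchi identity for the component `e ∧ f` of the curvature. -/
lemma bianchi_ef (hE : IsTypeNFrame g V E lam) (hg : LorentzOn g V) (hV : IsOpen V)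
    (hy : y ∈ V) (k m i : Fin 4) :
    wedge3 (fun i => connForm g E 0 2 i y) (fun i => E 0 i y) (fun i => E 1 i y) k m i
      + wedge3 (fun i => connForm g E 0 1 i y) (fun i => E 0 i y) (fun i => E 2 i y) k m i = 0 := by
  have hE' := hE.toIsNullFrame
  have dE : ∀ a i, DifferentiableAt ℝ (E a i) y := fun a i =>
    differentiableAt_of_smooth hV (hE.smooth a i) hy
  have hF : ∀ m i, ∀ z ∈ V, curvForm g E 1 2 m i z = - lam * wedge (E 1) (E 2) m i z := by
    intro m i z hz
    rw [hE.curvForm_eq hg hV hz]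
    simp [nullGram, coframe, wedge]; left; ring
  have dw : ∀ m i, DifferentiableAt ℝ (fun z => wedge (E 1) (E 2) m i z) y := fun m i =>
    ((dE 1 m).fun_mul (dE 2 i)).fun_sub ((dE 2 m).fun_mul (dE 1 i))
  have h := hE'.bianchi hg hV hy 1 2 k m i
  rw [pd_congr hV hy (hF m i), pd_congr hV hy (hF i k), pd_congr hV hy (hF k m),
    pd_const_mul (dw m i), pd_const_mul (dw i k), pd_const_mul (dw k m),
    pd_wedge (dE 1) (dE 2), pd_wedge (dE 1) (dE 2), pd_wedge (dE 1) (dE 2)] at h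
  obtain ⟨S, hS, hSs⟩ := hE'.exists_pd_frame hg hV hy
  simp only [hS, hE.curvForm_eq hg hV hy, Fin.sum_univ_four] at h
  obtain ⟨-, c11, c22, -, c13, c23, c21, -, c32, -⟩ := hE'.connForm_relations hg hV hy
  simp only [c11, c22, c13, c23, c21, c32, hSs _ m k, hSs _ i m, hSs _ k i] at h
  simp [nullGram, coframe, wedge] at h
  simp only [wedge3]
  linear_combination h

/-- The Bianchi identity for the component `ℓ ∧ e` of the curvature. -/
lemma bianchi_le (hE : IsTypeNFrame g V E lam) (hg : LorentzOn g V) (hV : IsOpen V)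
    (hy : y ∈ V) (k m i : Fin 4) :
    2 * wedge3 (fun i => connForm g E 0 0 i y) (fun i => E 0 i y) (fun i => E 1 i y) k m i
      + 2 * wedge3 (fun i => connForm g E 1 2 i y) (fun i => E 0 i y) (fun i => E 2 i y) k m i
      + wedge3 (fun i => connForm g E 0 1 i y) (fun i => E 0 i y) (fun i => E 3 i y) k m i
      - wedge3 (fun i => connForm g E 0 2 i y) (fun i => E 1 i y) (fun i => E 2 i y) k m i = 0 := by
  have hE' := hE.toIsNullFrame
  have dE : ∀ a i, DifferentiableAt ℝ (E a i) y := fun a i =>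
    differentiableAt_of_smooth hV (hE.smooth a i) hy
  have hF : ∀ m i, ∀ z ∈ V, curvForm g E 1 0 m i z
      = wedge (E 0) (E 1) m i z + lam * wedge (E 1) (E 3) m i z := by
    intro m i z hz
    rw [hE.curvForm_eq hg hV hz]
    simp [nullGram, coframe, wedge]; ring
  have dw : ∀ a b m i, DifferentiableAt ℝ (fun z => wedge (E a) (E b) m i z) y := fun a b m i =>
    ((dE a m).fun_mul (dE b i)).fun_sub ((dE b m).fun_mul (dE a i))
  have hd : ∀ k m i, pd k (curvForm g E 1 0 m i) y
      = pd k (fun z => wedge (E 0) (E 1) m i z) y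
        + lam * pd k (fun z => wedge (E 1) (E 3) m i z) y := fun k m i => by
    rw [pd_congr hV hy (hF m i), pd_add (dw 0 1 m i) ((dw 1 3 m i).const_mul lam),
      pd_const_mul (dw 1 3 m i)]
  have h := hE'.bianchi hg hV hy 1 0 k m i
  rw [hd, hd, hd] at h
  simp only [pd_wedge (dE 0) (dE 1), pd_wedge (dE 1) (dE 3)] at h
  obtain ⟨S, hS, hSs⟩ := hE'.exists_pd_frame hg hV hy
  simp only [hS, hE.curvForm_eq hg hV hy, Fin.sum_univ_four] at h
  obtain ⟨c03, c11, -, c30, c13, -, -, c31, c32, c33⟩ := hE'.connForm_relations hg hV hy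
  simp only [c03, c11, c30, c13, c31, c32, c33, hSs _ m k, hSs _ i m, hSs _ k i] at h
  simp [nullGram, coframe, wedge] at h
  simp only [wedge3]
  linear_combination h

/-- The null congruence of a type N Einstein space is geodesic and free of shear, and its expansion
and twist are tied to the propagation of the fundamental bivector along `ℓ`. -/
lemma optical_scalars (hE : IsTypeNFrame g V E lam) (hg : LorentzOn g V) (hV : IsOpen V)
    (hy : y ∈ V) :
    inner1 g (connForm g E 0 1) (E 0) y = 0 ∧ inner1 g (connForm g E 0 2) (E 0) y = 0 ∧
    inner1 g (connForm g E 0 1) (E 2) y = - inner1 g (connForm g E 0 2) (E 1) y ∧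
    inner1 g (connForm g E 0 1) (E 1) y = inner1 g (connForm g E 0 2) (E 2) y ∧
    inner1 g (connForm g E 0 1) (E 1) y = -2 * inner1 g (connForm g E 0 0) (E 0) y ∧
    inner1 g (connForm g E 0 1) (E 2) y = -2 * inner1 g (connForm g E 1 2) (E 0) y := by
  have G : ∀ a b, dot g y (fun i => E a i y) (fun i => E b i y) = nullGram a b := hE.gram y hy
  -- evaluation of the three Bianchi identities on vectors of the frame
  have h1 : ∀ p q r, eval3 (sharp g y fun i => E p i y) (sharp g y fun i => E q i y)
      (sharp g y fun i => E r i y)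
      (wedge3 (fun i => connForm g E 0 1 i y) (fun i => E 0 i y) (fun i => E 1 i y)
      + (-1 : ℝ) • wedge3 (fun i => connForm g E 0 2 i y) (fun i => E 0 i y) (fun i => E 2 i y))
      = 0 := fun p q r => by
    rw [← eval3_zero]; congr 1; funext k m i
    have := hE.bianchi_ln hg hV hy k m i
    simp only [Pi.add_apply, Pi.smul_apply, smul_eq_mul, Pi.zero_apply]; linarith
  have h2 : ∀ p q r, eval3 (sharp g y fun i => E p i y) (sharp g y fun i => E q i y)
      (sharp g y fun i => E r i y)
      (wedge3 (fun i => connForm g E 0 2 i y) (fun i => E 0 i y) (fun i => E 1 i y)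
      + wedge3 (fun i => connForm g E 0 1 i y) (fun i => E 0 i y) (fun i => E 2 i y))
      = 0 := fun p q r => by
    rw [← eval3_zero]; congr 1; funext k m i
    exact hE.bianchi_ef hg hV hy k m i
  have h3 : ∀ p q r, eval3 (sharp g y fun i => E p i y) (sharp g y fun i => E q i y)
      (sharp g y fun i => E r i y)
      ((2 : ℝ) • wedge3 (fun i => connForm g E 0 0 i y) (fun i => E 0 i y) (fun i => E 1 i y)
      + (2 : ℝ) • wedge3 (fun i => connForm g E 1 2 i y) (fun i => E 0 i y) (fun i => E 2 i y)
      + wedge3 (fun i => connForm g E 0 1 i y) (fun i => E 0 i y) (fun i => E 3 i y)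
      + (-1 : ℝ) • wedge3 (fun i => connForm g E 0 2 i y) (fun i => E 1 i y) (fun i => E 2 i y))
      = 0 := fun p q r => by
    rw [← eval3_zero]; congr 1; funext k m i
    have := hE.bianchi_le hg hV hy k m i
    simp only [Pi.add_apply, Pi.smul_apply, smul_eq_mul, Pi.zero_apply]; linarith
  simp only [eval3_add, eval3_smul, eval3_wedge3, G] at h1 h2 h3
  have a1 := h1 0 3 1
  have a2 := h1 0 3 2
  have a3 := h1 1 2 3
  have b3 := h2 1 2 3
  have c1 := h3 0 3 1
  have c2 := h3 0 3 2
  simp [nullGram] at a1 a2 a3 b3 c1 c2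
  simp only [inner1_eq_dot]
  refine ⟨?_, ?_, ?_, ?_, ?_, ?_⟩ <;> linarith

end IsTypeNFrame
end Bianchi

/-! ### Two-forms and their covariant derivatives -/

section TwoForms

variable {g : Tensor2 ℝ} {V : Set Coord} {y : Coord} {E : Fin 4 → Tensor1 ℝ} {lam : ℝ}

lemma inner2_add_left (F G H : Tensor2 ℝ) :
    inner2 g (fun i j z => F i j z + G i j z) H y = inner2 g F H y + inner2 g G H y := by
  simp only [inner2, smul_eq_mul, ← mul_add, ← Finset.sum_add_distrib]
  congr 1
  exact Finset.sum_congr rfl fun i _ => Finset.sum_congr rfl fun j _ =>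
    Finset.sum_congr rfl fun k _ => Finset.sum_congr rfl fun l _ => by ring

lemma inner2_smul_left (c : Coord → ℝ) (F H : Tensor2 ℝ) :
    inner2 g (fun i j z => c z * F i j z) H y = c y * inner2 g F H y := by
  simp only [inner2, smul_eq_mul, Finset.mul_sum]
  exact Finset.sum_congr rfl fun i _ => Finset.sum_congr rfl fun j _ =>
    Finset.sum_congr rfl fun k _ => Finset.sum_congr rfl fun l _ => by ring

lemma inner2_add_right (F G H : Tensor2 ℝ) :
    inner2 g H (fun i j z => F i j z + G i j z) y = inner2 g H F y + inner2 g H G y := by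
  simp only [inner2, smul_eq_mul, ← mul_add, ← Finset.sum_add_distrib]

lemma inner2_smul_right (c : Coord → ℝ) (F H : Tensor2 ℝ) :
    inner2 g H (fun i j z => c z * F i j z) y = c y * inner2 g H F y := by
  simp only [inner2, smul_eq_mul, Finset.mul_sum]
  exact Finset.sum_congr rfl fun i _ => Finset.sum_congr rfl fun j _ =>
    Finset.sum_congr rfl fun k _ => Finset.sum_congr rfl fun l _ => by ring

lemma inner2_congr {A : Type} [NormedField A] [NormedAlgebra ℝ A] {F F' H H' : Tensor2 A}
    (hF : ∀ i j, F i j y = F' i j y) (hH : ∀ i j, H i j y = H' i j y) :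
    inner2 g F H y = inner2 g F' H' y := by
  simp only [inner2, hF, hH]

/-- The scalar product of two complex 2-forms of the shape `c (P - i Q)`. -/
lemma inner2_complex (c : ℂ) (P Q : Tensor2 ℝ) (F : Tensor2 ℂ)
    (hF : ∀ i j, F i j y = c * ((P i j y : ℂ) - Complex.I * (Q i j y : ℂ))) :
    inner2 g F F y = c ^ 2 * (((inner2 g P P y : ℝ) : ℂ) - ((inner2 g Q Q y : ℝ) : ℂ)
      - Complex.I * (((inner2 g P Q y : ℝ) : ℂ) + ((inner2 g Q P y : ℝ) : ℂ))) := by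
  simp only [inner2, hF, Complex.real_smul, Complex.ofReal_mul, Complex.ofReal_sum, smul_eq_mul,
    Finset.mul_sum, ← Finset.sum_sub_distrib, ← Finset.sum_add_distrib]
  refine Finset.sum_congr rfl fun i _ => Finset.sum_congr rfl fun j _ =>
    Finset.sum_congr rfl fun k _ => Finset.sum_congr rfl fun l _ => ?_
  linear_combination ((1 / 2 : ℝ) : ℂ) * (ginv g i k y : ℂ) * (ginv g j l y : ℂ) * c ^ 2
    * (Q i j y : ℂ) * (Q k l y : ℂ) * Complex.I_sq

lemma inner2_wedge (u v w z : Tensor1 ℝ) :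
    inner2 g (wedge u v) (wedge w z) y
      = inner1 g u w y * inner1 g v z y - inner1 g u z y * inner1 g v w y := by
  simp only [inner2, inner1, wedge, smul_eq_mul, Fin.sum_univ_four]
  ring

lemma nabla2_congr {A : Type} [NormedField A] [NormedAlgebra ℝ A] (hV : IsOpen V) (hy : y ∈ V)
    {F H : Tensor2 A} (h : ∀ z ∈ V, ∀ i j, F i j z = H i j z) (i j k : Fin 4) :
    nabla2 g F i j k y = nabla2 g H i j k y := by
  simp only [nabla2, pd_congr hV hy (fun z hz => h z hz j k), h y hy]

lemma nabla2_wedge {u v : Tensor1 ℝ} (hu : ∀ i, DifferentiableAt ℝ (u i) y)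
    (hv : ∀ i, DifferentiableAt ℝ (v i) y) (i j k : Fin 4) :
    nabla2 g (wedge u v) i j k y = nabla1 g u i j y * v k y + u j y * nabla1 g v i k y
      - (nabla1 g v i j y * u k y + v j y * nabla1 g u i k y) := by
  have : pd i (wedge u v j k) y = _ := pd_wedge hu hv i j k
  simp only [nabla2, this, nabla1, wedge, smul_eq_mul, Fin.sum_univ_four]
  ring

/-- The covariant derivative of `ℓ ∧ e` in terms of the connection forms. -/
lemma IsNullFrame.nabla2_le (hE : IsNullFrame g V E) (hg : LorentzOn g V) (hV : IsOpen V)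
    (hy : y ∈ V) (i j k : Fin 4) :
    nabla2 g (wedge (E 0) (E 1)) i j k y
      = connForm g E 0 0 i y * wedge (E 0) (E 1) j k y
        + connForm g E 1 2 i y * wedge (E 0) (E 2) j k y
        + connForm g E 0 1 i y * wedge (E 0) (E 3) j k y
        + - connForm g E 0 2 i y * wedge (E 1) (E 2) j k y := by
  have dE : ∀ a i, DifferentiableAt ℝ (E a i) y := fun a i =>
    differentiableAt_of_smooth hV (hE.smooth a i) hy
  obtain ⟨c03, c11, -, -, c13, -, -, -, -, -⟩ := hE.connForm_relations hg hV hy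
  rw [nabla2_wedge (dE 0) (dE 1)]
  simp only [hE.nabla_frame hy, Fin.sum_univ_four, c03, c11, c13, wedge]
  ring

/-- The covariant derivative of `ℓ ∧ f` in terms of the connection forms. -/
lemma IsNullFrame.nabla2_lf (hE : IsNullFrame g V E) (hg : LorentzOn g V) (hV : IsOpen V)
    (hy : y ∈ V) (i j k : Fin 4) :
    nabla2 g (wedge (E 0) (E 2)) i j k y
      = connForm g E 0 0 i y * wedge (E 0) (E 2) j k y
        + - connForm g E 1 2 i y * wedge (E 0) (E 1) j k y
        + connForm g E 0 2 i y * wedge (E 0) (E 3) j k y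
        + connForm g E 0 1 i y * wedge (E 1) (E 2) j k y := by
  have dE : ∀ a i, DifferentiableAt ℝ (E a i) y := fun a i =>
    differentiableAt_of_smooth hV (hE.smooth a i) hy
  obtain ⟨c03, -, c22, -, -, c23, c21, -, -, -⟩ := hE.connForm_relations hg hV hy
  rw [nabla2_wedge (dE 0) (dE 2)]
  simp only [hE.nabla_frame hy, Fin.sum_univ_four, c03, c22, c23, c21, wedge]
  ring

lemma pd_ofReal {f : Coord → ℝ} (hf : DifferentiableAt ℝ f y) (i : Fin 4) :
    pd i (fun z => (f z : ℂ)) y = ((pd i f y : ℝ) : ℂ) := by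
  have h := (Complex.ofRealCLM.hasFDerivAt (x := f y)).comp y hf.hasFDerivAt
  have : fderiv ℝ (fun z => (f z : ℂ)) y = Complex.ofRealCLM.comp (fderiv ℝ f y) := h.fderiv
  simp [pd, this]

lemma nabla2_bivector {o : ℝ} {F : Tensor2 ℝ} (hF : ∀ i j, DifferentiableAt ℝ (F i j) y)
    (hH : ∀ i j, DifferentiableAt ℝ (hodge g o F i j) y) (i j k : Fin 4) :
    nabla2 g (bivector g o F) i j k y = ((1 / √2 : ℝ) : ℂ) * (((nabla2 g F i j k y : ℝ) : ℂ)
      - Complex.I * ((nabla2 g (hodge g o F) i j k y : ℝ) : ℂ)) := by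
  have hpd : pd i (bivector g o F j k) y = ((1 / √2 : ℝ) : ℂ) * (((pd i (F j k) y : ℝ) : ℂ)
      - Complex.I * ((pd i (hodge g o F j k) y : ℝ) : ℂ)) := by
    have d1 : DifferentiableAt ℝ (fun z => (F j k z : ℂ)) y :=
      Complex.ofRealCLM.differentiableAt.comp y (hF j k)
    have d2 : DifferentiableAt ℝ (fun z => (hodge g o F j k z : ℂ)) y :=
      Complex.ofRealCLM.differentiableAt.comp y (hH j k)
    rw [← pd_ofReal (hF j k), ← pd_ofReal (hH j k)]
    simp only [pd]
    have : bivector g o F j k = fun z => ((1 / √2 : ℝ) : ℂ) * ((F j k z : ℂ)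
      - Complex.I * (hodge g o F j k z : ℂ)) := rfl
    rw [this, fderiv_const_mul (d1.fun_sub (d2.const_mul _)), fderiv_fun_sub d1 (d2.const_mul _),
      fderiv_const_mul d2]
    simp
  simp only [nabla2, hpd, Complex.real_smul, smul_eq_mul, bivector, Complex.ofReal_sub,
    Complex.ofReal_add, Complex.ofReal_mul, Fin.sum_univ_four]
  ring

/-- The square of the derivative of the fundamental bivector along `v`: the terms along
the bivector itself are null, and only the derivative of the direction of `ℓ` contributes. -/
lemma IsNullFrame.inner2_nablaAlong (hE : IsNullFrame g V E) (hg : LorentzOn g V) (hV : IsOpen V)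
    (hy : y ∈ V) {o : ℝ} {L : Tensor2 ℝ} (hL : ∀ z ∈ V, ∀ i j, L i j z = wedge (E 0) (E 1) i j z)
    (hH : ∀ z ∈ V, ∀ i j, hodge g o L i j z = wedge (E 0) (E 2) i j z) (v : Tensor1 ℝ) :
    inner2 g (nablaAlong g v (bivector g o L)) (nablaAlong g v (bivector g o L)) y
      = - ((inner1 g (connForm g E 0 1) v y : ℂ)
        - Complex.I * (inner1 g (connForm g E 0 2) v y : ℂ)) ^ 2 := by
  have dE : ∀ a b i j, DifferentiableAt ℝ (wedge (E a) (E b) i j) y := fun a b i j =>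
    differentiableAt_of_smooth hV (((hE.smooth a i).mul (hE.smooth b j)).sub
      ((hE.smooth b i).mul (hE.smooth a j))) hy
  have dL : ∀ i j, DifferentiableAt ℝ (L i j) y := fun i j =>
    (dE 0 1 i j).congr_of_eventuallyEq
      (Filter.eventually_of_mem (hV.mem_nhds hy) fun z hz => hL z hz i j)
  have dH : ∀ i j, DifferentiableAt ℝ (hodge g o L i j) y := fun i j =>
    (dE 0 2 i j).congr_of_eventuallyEq
      (Filter.eventually_of_mem (hV.mem_nhds hy) fun z hz => hH z hz i j)
  have hsum : ∀ a b, inner1 g (connForm g E a b) v y = ∑ i, connForm g E a b i y * up g v i y :=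
    fun a b => dot_eq_sum_mul_sharp _ _
  -- the real and imaginary parts
  let P : Tensor2 ℝ := fun j k z =>
    ((inner1 g (connForm g E 0 0) v z * wedge (E 0) (E 1) j k z
    + inner1 g (connForm g E 1 2) v z * wedge (E 0) (E 2) j k z)
    + inner1 g (connForm g E 0 1) v z * wedge (E 0) (E 3) j k z)
    + (- inner1 g (connForm g E 0 2) v z) * wedge (E 1) (E 2) j k z
  let Q : Tensor2 ℝ := fun j k z =>
    ((inner1 g (connForm g E 0 0) v z * wedge (E 0) (E 2) j k z
    + (- inner1 g (connForm g E 1 2) v z) * wedge (E 0) (E 1) j k z)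
    + inner1 g (connForm g E 0 2) v z * wedge (E 0) (E 3) j k z)
    + inner1 g (connForm g E 0 1) v z * wedge (E 1) (E 2) j k z
  have hPQ : ∀ j k, nablaAlong g v (bivector g o L) j k y
      = ((1 / √2 : ℝ) : ℂ) * ((P j k y : ℂ) - Complex.I * (Q j k y : ℂ)) := by
    intro j k
    simp only [nablaAlong, nabla2_bivector dL dH, nabla2_congr hV hy hL, nabla2_congr hV hy hH,
      hE.nabla2_le hg hV hy, hE.nabla2_lf hg hV hy, P, Q, hsum, Fin.sum_univ_four,
      Complex.real_smul, Complex.ofReal_add, Complex.ofReal_mul, Complex.ofReal_neg]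
    ring
  have hc : ((1 / √2 : ℝ) : ℂ) ^ 2 = 1 / 2 := by
    rw [← Complex.ofReal_pow, div_pow, Real.sq_sqrt (by norm_num)]; norm_num
  rw [inner2_complex _ P Q _ hPQ, hc]
  simp only [P, Q, inner2_add_left, inner2_add_right, inner2_smul_left, inner2_smul_right]
  have hw : ∀ a b c d, inner2 g (fun i j z => wedge (E a) (E b) i j z)
      (fun i j z => wedge (E c) (E d) i j z) y
      = nullGram a c * nullGram b d - nullGram a d * nullGram b c := fun a b c d => by
    have := inner2_wedge (g := g) (y := y) (E a) (E b) (E c) (E d)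
    simpa only [hE.gram y hy] using this
  simp only [hw]
  simp [nullGram]
  linear_combination (inner1 g (connForm g E 0 2) v y : ℂ) ^ 2 * Complex.I_sq

end TwoForms

/-! ### The invariants in an adapted null frame -/

section AdaptedFrames

variable {g : Tensor2 ℝ} {U : Set Coord} {y : Coord} {E : Fin 4 → Tensor1 ℝ} {lam : ℝ}

/-- The contraction of a wedge product with two vectors. -/
lemma sum_wedge_up_up (u v p q : Tensor1 ℝ) :
    ∑ j, ∑ k, wedge u v j k y * up g p k y * up g q j y
      = inner1 g u q y * inner1 g v p y - inner1 g v q y * inner1 g u p y := by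
  simp only [inner1_eq_dot, dot_eq_sum_mul_sharp, ← up_eq_sharp, wedge, Fin.sum_univ_four]
  ring

/-- A null frame `(ℓ, e, f, n)` adapted to fundamental data: `ℓ` is the fundamental vector,
`L = ℓ ∧ e`, `*L = ℓ ∧ f`, and `e`, `f` are orthogonal to the auxiliary vector field `x`. -/
structure IsAdaptedFrame (S : FundamentalData U g) (E : Fin 4 → Tensor1 ℝ) (lam : ℝ) : Prop
    extends IsTypeNFrame g S.V E lam where
  ell_eq : E 0 = S.ℓ
  L_eq : ∀ y ∈ S.V, ∀ i j, S.L i j y = wedge (E 0) (E 1) i j y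
  hodge_eq : ∀ y ∈ S.V, ∀ i j, hodge g S.o S.L i j y = wedge (E 0) (E 2) i j y
  e_x : ∀ y ∈ S.V, inner1 g (E 1) S.x y = 0
  f_x : ∀ y ∈ S.V, inner1 g (E 2) S.x y = 0
  lx_ne : ∀ y ∈ S.V, S.lx y ≠ 0

namespace IsAdaptedFrame

variable {S : FundamentalData U g}

lemma nabla2_L (hE : IsAdaptedFrame S E lam) (hg : LorentzOn g S.V) (hy : y ∈ S.V)
    (i j k : Fin 4) : nabla2 g S.L i j k y
      = connForm g E 0 0 i y * wedge (E 0) (E 1) j k y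
        + connForm g E 1 2 i y * wedge (E 0) (E 2) j k y
        + connForm g E 0 1 i y * wedge (E 0) (E 3) j k y
        + - connForm g E 0 2 i y * wedge (E 1) (E 2) j k y := by
  rw [nabla2_congr S.isOpen_V hy hE.L_eq, hE.toIsNullFrame.nabla2_le hg S.isOpen_V hy]

lemma nabla2_hodge (hE : IsAdaptedFrame S E lam) (hg : LorentzOn g S.V) (hy : y ∈ S.V)
    (i j k : Fin 4) : nabla2 g (hodge g S.o S.L) i j k y
      = connForm g E 0 0 i y * wedge (E 0) (E 2) j k y
        + - connForm g E 1 2 i y * wedge (E 0) (E 1) j k y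
        + connForm g E 0 2 i y * wedge (E 0) (E 3) j k y
        + connForm g E 0 1 i y * wedge (E 1) (E 2) j k y := by
  rw [nabla2_congr S.isOpen_V hy hE.hodge_eq, hE.toIsNullFrame.nabla2_lf hg S.isOpen_V hy]

lemma lx_eq (hE : IsAdaptedFrame S E lam) : inner1 g (E 0) S.x y = S.lx y := by
  rw [hE.ell_eq]; rfl

lemma sum_wedge_ell_x (hE : IsAdaptedFrame S E lam) (hy : y ∈ S.V) (a b : Fin 4) :
    ∑ j, ∑ k, wedge (E a) (E b) j k y * up g S.ℓ k y * up g S.x j y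
      = inner1 g (E a) S.x y * nullGram b 0 - inner1 g (E b) S.x y * nullGram a 0 := by
  rw [sum_wedge_up_up, ← hE.ell_eq, hE.gram y hy, hE.gram y hy]

/-- The vector `a` is the component of `∇ℓ` along `e`. -/
lemma a_eq (hE : IsAdaptedFrame S E lam) (hg : LorentzOn g S.V) (hy : y ∈ S.V) (i : Fin 4) :
    S.a i y = connForm g E 0 1 i y := by
  have h : ∑ j, ∑ k, nabla2 g S.L i j k y * up g S.ℓ k y * up g S.x j y
      = - connForm g E 0 1 i y * S.lx y := by
    have := fun a b => hE.sum_wedge_ell_x hy a b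
    have e : ∑ j, ∑ k, nabla2 g S.L i j k y * up g S.ℓ k y * up g S.x j y
      = connForm g E 0 0 i y * (∑ j, ∑ k, wedge (E 0) (E 1) j k y * up g S.ℓ k y * up g S.x j y)
        + connForm g E 1 2 i y * (∑ j, ∑ k, wedge (E 0) (E 2) j k y * up g S.ℓ k y * up g S.x j y)
        + connForm g E 0 1 i y * (∑ j, ∑ k, wedge (E 0) (E 3) j k y * up g S.ℓ k y * up g S.x j y)
        - connForm g E 0 2 i y
          * (∑ j, ∑ k, wedge (E 1) (E 2) j k y * up g S.ℓ k y * up g S.x j y) := by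
      simp only [Finset.mul_sum, ← Finset.sum_add_distrib, ← Finset.sum_sub_distrib]
      exact Finset.sum_congr rfl fun j _ => Finset.sum_congr rfl fun k _ => by
        rw [hE.nabla2_L hg hy]; ring
    rw [e, this, this, this, this, hE.lx_eq]
    simp [nullGram]
  have := hE.lx_ne y hy
  rw [FundamentalData.a, h]
  field_simp

/-- The vector `a*` is minus the component of `∇ℓ` along `f`. -/
lemma aStar_eq (hE : IsAdaptedFrame S E lam) (hg : LorentzOn g S.V) (hy : y ∈ S.V) (i : Fin 4) :
    S.aStar i y = - connForm g E 0 2 i y := by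
  have h : ∑ j, ∑ k, nabla2 g (hodge g S.o S.L) i j k y * up g S.ℓ k y * up g S.x j y
      = - connForm g E 0 2 i y * S.lx y := by
    have := fun a b => hE.sum_wedge_ell_x hy a b
    have e : ∑ j, ∑ k, nabla2 g (hodge g S.o S.L) i j k y * up g S.ℓ k y * up g S.x j y
      = connForm g E 0 0 i y * (∑ j, ∑ k, wedge (E 0) (E 2) j k y * up g S.ℓ k y * up g S.x j y)
        - connForm g E 1 2 i y * (∑ j, ∑ k, wedge (E 0) (E 1) j k y * up g S.ℓ k y * up g S.x j y)
        + connForm g E 0 2 i y * (∑ j, ∑ k, wedge (E 0) (E 3) j k y * up g S.ℓ k y * up g S.x j y)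
        + connForm g E 0 1 i y
          * (∑ j, ∑ k, wedge (E 1) (E 2) j k y * up g S.ℓ k y * up g S.x j y) := by
      simp only [Finset.mul_sum, ← Finset.sum_add_distrib, ← Finset.sum_sub_distrib]
      exact Finset.sum_congr rfl fun j _ => Finset.sum_congr rfl fun k _ => by
        rw [hE.nabla2_hodge hg hy]; ring
    rw [e, this, this, this, this, hE.lx_eq]
    simp [nullGram]
  have := hE.lx_ne y hy
  rw [FundamentalData.aStar, h]
  field_simp

/-- The covector `b`, in terms of the connection forms. -/
lemma b_eq (hE : IsAdaptedFrame S E lam) (hg : LorentzOn g S.V) (hy : y ∈ S.V) (i : Fin 4) :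
    S.b i y = connForm g E 0 0 i y
      + inner1 g (connForm g E 0 1) S.x y / S.lx y * E 1 i y
      + inner1 g (connForm g E 0 2) S.x y / S.lx y * E 2 i y := by
  have hlx := hE.lx_ne y hy
  have hsum : ∀ v : Tensor1 ℝ, ∑ j, v j y * up g S.x j y = inner1 g v S.x y :=
    fun v => (dot_eq_sum_mul_sharp _ _).symm
  have hn : ∀ i j, nabla1 g S.ℓ i j y = connForm g E 0 0 i y * E 0 j y
      + connForm g E 0 1 i y * E 1 j y + connForm g E 0 2 i y * E 2 j y := by
    intro i j
    rw [← hE.ell_eq, hE.nabla_frame hy, Fin.sum_univ_four,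
      (hE.toIsNullFrame.connForm_relations hg S.isOpen_V hy).1]
    ring
  have hBx : ∀ i, S.Bx i y = connForm g E 0 0 i y * S.lx y
      + inner1 g (connForm g E 0 0) S.x y * E 0 i y
      + inner1 g (connForm g E 0 1) S.x y * E 1 i y
      + inner1 g (connForm g E 0 2) S.x y * E 2 i y := by
    intro i
    have e : S.Bx i y = connForm g E 0 0 i y * (∑ j, E 0 j y * up g S.x j y)
        + connForm g E 0 1 i y * (∑ j, E 1 j y * up g S.x j y)
        + connForm g E 0 2 i y * (∑ j, E 2 j y * up g S.x j y)
        + (∑ j, connForm g E 0 0 j y * up g S.x j y) * E 0 i y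
        + (∑ j, connForm g E 0 1 j y * up g S.x j y) * E 1 i y
        + (∑ j, connForm g E 0 2 j y * up g S.x j y) * E 2 i y := by
      simp only [FundamentalData.Bx, FundamentalData.B, hn, Finset.mul_sum, Finset.sum_mul,
        ← Finset.sum_add_distrib]
      exact Finset.sum_congr rfl fun j _ => by ring
    rw [e, hsum, hsum, hsum, hsum, hsum, hsum, hE.lx_eq, hE.e_x y hy, hE.f_x y hy]
    ring
  have hBxx : ∑ j, S.Bx j y * up g S.x j y = 2 * inner1 g (connForm g E 0 0) S.x y * S.lx y := by
    have e : ∑ j, S.Bx j y * up g S.x j y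
        = (∑ j, connForm g E 0 0 j y * up g S.x j y) * S.lx y
        + inner1 g (connForm g E 0 0) S.x y * (∑ j, E 0 j y * up g S.x j y)
        + inner1 g (connForm g E 0 1) S.x y * (∑ j, E 1 j y * up g S.x j y)
        + inner1 g (connForm g E 0 2) S.x y * (∑ j, E 2 j y * up g S.x j y) := by
      simp only [hBx, Finset.mul_sum, Finset.sum_mul, ← Finset.sum_add_distrib]
      exact Finset.sum_congr rfl fun j _ => by ring
    rw [e, hsum, hsum, hsum, hsum, hE.lx_eq, hE.e_x y hy, hE.f_x y hy]
    ring
  rw [FundamentalData.b, hBxx, hBx, ← hE.ell_eq]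
  field_simp
  ring

lemma preC_eq (hE : IsAdaptedFrame S E lam) (hg : LorentzOn g S.V)
    (hy : y ∈ S.V) (i j k : Fin 4) :
    S.preC i j k y = - connForm g E 1 2 i y * E 0 j y * E 0 k y
      + connForm g E 0 2 i y * E 0 j y * E 1 k y - connForm g E 0 1 i y * E 2 j y * E 0 k y := by
  have hw : ∀ a b c d, ∑ m, ∑ n, wedge (E a) (E b) j n y * ginv g n m y * wedge (E c) (E d) k m y
      = E a j y * E c k y * nullGram b d - E a j y * E d k y * nullGram b c
        - E b j y * E c k y * nullGram a d + E b j y * E d k y * nullGram a c := by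
    intro a b c d
    simp only [← hE.gram y hy, inner1, wedge, Fin.sum_univ_four]
    ring
  have e : S.preC i j k y
      = connForm g E 0 0 i y
          * (∑ m, ∑ n, wedge (E 0) (E 2) j n y * ginv g n m y * wedge (E 0) (E 1) k m y)
        - connForm g E 1 2 i y
          * (∑ m, ∑ n, wedge (E 0) (E 1) j n y * ginv g n m y * wedge (E 0) (E 1) k m y)
        + connForm g E 0 2 i y
          * (∑ m, ∑ n, wedge (E 0) (E 3) j n y * ginv g n m y * wedge (E 0) (E 1) k m y)
        + connForm g E 0 1 i y
          * (∑ m, ∑ n, wedge (E 1) (E 2) j n y * ginv g n m y * wedge (E 0) (E 1) k m y) := by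
    simp only [FundamentalData.preC, Finset.mul_sum, ← Finset.sum_add_distrib,
      ← Finset.sum_sub_distrib]
    exact Finset.sum_congr rfl fun m _ => Finset.sum_congr rfl fun n _ => by
      rw [hE.nabla2_hodge hg hy, hE.L_eq y hy]; ring
  rw [e, hw, hw, hw, hw]
  simp [nullGram]
  ring

/-- The covector `c`, in terms of the connection forms. -/
lemma c_eq (hE : IsAdaptedFrame S E lam) (hg : LorentzOn g S.V) (hy : y ∈ S.V) (i : Fin 4) :
    S.c i y = - connForm g E 1 2 i y
      - inner1 g (connForm g E 0 1) S.x y / S.lx y * E 2 i y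
      + inner1 g (connForm g E 0 2) S.x y / S.lx y * E 1 i y := by
  have hlx := hE.lx_ne y hy
  have hsum : ∀ v : Tensor1 ℝ, ∑ j, v j y * up g S.x j y = inner1 g v S.x y :=
    fun v => (dot_eq_sum_mul_sharp _ _).symm
  have h0 : ∑ j, E 0 j y * up g S.x j y = S.lx y := by rw [hsum, hE.lx_eq]
  have h1 : ∑ j, E 1 j y * up g S.x j y = 0 := by rw [hsum, hE.e_x y hy]
  have h2 : ∑ j, E 2 j y * up g S.x j y = 0 := by rw [hsum, hE.f_x y hy]
  have hw : ∑ j, connForm g E 1 2 j y * up g S.x j y = inner1 g (connForm g E 1 2) S.x y := hsum _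
  have ha : ∑ j, connForm g E 0 1 j y * up g S.x j y = inner1 g (connForm g E 0 1) S.x y := hsum _
  have ha' : ∑ j, connForm g E 0 2 j y * up g S.x j y = inner1 g (connForm g E 0 2) S.x y :=
    hsum _
  have hCxx : ∀ i, S.Cxx i y = 1 / 3 * (- connForm g E 1 2 i y * S.lx y ^ 2
      - 2 * inner1 g (connForm g E 1 2) S.x y * S.lx y * E 0 i y
      - inner1 g (connForm g E 0 1) S.x y * S.lx y * E 2 i y
      + inner1 g (connForm g E 0 2) S.x y * S.lx y * E 1 i y) := by
    intro i
    simp only [FundamentalData.Cxx, FundamentalData.C, hE.preC_eq hg hy]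
    have e : ∀ w a a' l p q x : Fin 4 → ℝ, ∑ j, ∑ k, 1 / 6 * (
        (-w i * l j * l k + a' i * l j * p k - a i * q j * l k)
        + (-w i * l k * l j + a' i * l k * p j - a i * q k * l j)
        + (-w j * l i * l k + a' j * l i * p k - a j * q i * l k)
        + (-w j * l k * l i + a' j * l k * p i - a j * q k * l i)
        + (-w k * l i * l j + a' k * l i * p j - a k * q i * l j)
        + (-w k * l j * l i + a' k * l j * p i - a k * q j * l i)) * x j * x k
        = 1 / 3 * (- w i * (∑ j, l j * x j) ^ 2
          - 2 * (∑ j, w j * x j) * (∑ j, l j * x j) * l i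
          - (∑ j, a j * x j) * (∑ j, l j * x j) * q i
          + (∑ j, a' j * x j) * (∑ j, l j * x j) * p i
          + (∑ j, p j * x j) * (a' i * (∑ j, l j * x j) + (∑ j, a' j * x j) * l i)
          - (∑ j, q j * x j) * (a i * (∑ j, l j * x j) + (∑ j, a j * x j) * l i)) := by
      intro w a a' l p q x
      simp only [Fin.sum_univ_four]
      ring
    rw [e (fun i => connForm g E 1 2 i y) (fun i => connForm g E 0 1 i y)
      (fun i => connForm g E 0 2 i y) (fun i => E 0 i y) (fun i => E 1 i y) (fun i => E 2 i y)
      (fun i => up g S.x i y), h0, h1, h2, hw, ha, ha']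
    ring
  have hCxxx : ∑ j, S.Cxx j y * up g S.x j y
      = - inner1 g (connForm g E 1 2) S.x y * S.lx y ^ 2 := by
    have e : ∑ j, S.Cxx j y * up g S.x j y
        = 1 / 3 * (- (∑ j, connForm g E 1 2 j y * up g S.x j y) * S.lx y ^ 2
          - 2 * inner1 g (connForm g E 1 2) S.x y * S.lx y * (∑ j, E 0 j y * up g S.x j y)
          - inner1 g (connForm g E 0 1) S.x y * S.lx y * (∑ j, E 2 j y * up g S.x j y)
          + inner1 g (connForm g E 0 2) S.x y * S.lx y * (∑ j, E 1 j y * up g S.x j y)) := by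
      simp only [hCxx, Finset.mul_sum, ← Finset.sum_add_distrib, ← Finset.sum_sub_distrib,
        Finset.sum_mul, ← Finset.sum_neg_distrib]
      exact Finset.sum_congr rfl fun j _ => by ring
    rw [e, hw, h0, h1, h2]; ring
  rw [FundamentalData.c, hCxxx, hCxx, ← hE.ell_eq]
  field_simp
  ring

end IsAdaptedFrame
end AdaptedFrames

/-! ### Vanishing of the invariants -/

section Vanishing

variable {g : Tensor2 ℝ} {U : Set Coord} {y : Coord} {E : Fin 4 → Tensor1 ℝ} {lam : ℝ}

lemma inner1_congr {v v' w w' : Tensor1 ℝ} (hv : ∀ i, v i y = v' i y) (hw : ∀ i, w i y = w' i y) :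
    inner1 g v w y = inner1 g v' w' y := by
  simp only [inner1, hv, hw]

lemma eps_swap (i j k l : Fin 4) : eps i j k l = - eps i k j l := by
  revert i j k l; decide

lemma hodgeWedge3_eq_zero (o : ℝ) {u v : Tensor1 ℝ} (w : Tensor1 ℝ) {s : ℝ}
    (hv : ∀ i, v i y = s * u i y) (i : Fin 4) : hodgeWedge3 g o u v w i y = 0 := by
  have hup : ∀ k, up g v k y = s * up g u k y := by
    intro k
    simp only [up, hv, Finset.mul_sum]
    exact Finset.sum_congr rfl fun j _ => by ring
  have hneg : hodgeWedge3 g o u v w i y = - hodgeWedge3 g o u v w i y := by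
    conv_lhs => rw [hodgeWedge3, Finset.sum_comm]
    simp only [hodgeWedge3, ← Finset.sum_neg_distrib, hup]
    refine Finset.sum_congr rfl fun j _ => Finset.sum_congr rfl fun k _ =>
      Finset.sum_congr rfl fun l _ => ?_
    rw [vol, vol, eps_swap i k j l]
    push_cast; ring
  linarith

lemma IsNullFrame.expand_inner1 {V : Set Coord} (hE : IsNullFrame g V E) (hy : y ∈ V)
    (v : Tensor1 ℝ) (j : Fin 4) :
    v j y = - inner1 g v (E 3) y * E 0 j y + inner1 g v (E 1) y * E 1 j y
      + inner1 g v (E 2) y * E 2 j y - inner1 g v (E 0) y * E 3 j y := by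
  have h := hE.expand hy (fun i => v i y) j
  have h0 : dot g y (fun i => v i y) (fun i => coframe E 0 i y) = - inner1 g v (E 3) y :=
    dot_neg_right _ _
  have h3 : dot g y (fun i => v i y) (fun i => coframe E 3 i y) = - inner1 g v (E 0) y :=
    dot_neg_right _ _
  have h1 : dot g y (fun i => v i y) (fun i => coframe E 1 i y) = inner1 g v (E 1) y := rfl
  have h2 : dot g y (fun i => v i y) (fun i => coframe E 2 i y) = inner1 g v (E 2) y := rfl
  rw [Fin.sum_univ_four, h0, h1, h2, h3] at h
  rw [h]; ring

lemma IsNullFrame.inner1_self {V : Set Coord} (hE : IsNullFrame g V E) (hy : y ∈ V)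
    (v : Tensor1 ℝ) (hv : inner1 g v (E 0) y = 0) :
    inner1 g v v y = inner1 g v (E 1) y ^ 2 + inner1 g v (E 2) y ^ 2 := by
  have e : inner1 g v v y = - inner1 g v (E 3) y * inner1 g v (E 0) y
      + inner1 g v (E 1) y * inner1 g v (E 1) y
      + inner1 g v (E 2) y * inner1 g v (E 2) y - inner1 g v (E 0) y * inner1 g v (E 3) y := by
    have hv : (fun i => v i y) = (- inner1 g v (E 3) y) • (fun i => E 0 i y)
        + inner1 g v (E 1) y • (fun i => E 1 i y) + inner1 g v (E 2) y • (fun i => E 2 i y)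
        - inner1 g v (E 0) y • (fun i => E 3 i y) := funext fun j => hE.expand_inner1 hy v j
    rw [inner1_eq_dot, congrArg (dot g y fun i => v i y) hv]
    simp only [dot_sub_right, dot_add_right, dot_smul_right]
    rfl
  rw [e, hv]; ring

namespace IsAdaptedFrame

variable {S : FundamentalData U g}

/-- The null congruence is geodesic. -/
lemma phi1_eq_zero (hE : IsAdaptedFrame S E lam) (hg : LorentzOn g S.V) (hy : y ∈ S.V) :
    S.phi1 y = 0 := by
  have h := hE.toIsNullFrame.inner2_nablaAlong hg S.isOpen_V hy hE.L_eq hE.hodge_eq S.ℓ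
  obtain ⟨h1, h2, -⟩ := hE.toIsTypeNFrame.optical_scalars hg S.isOpen_V hy
  rw [← hE.ell_eq, h1, h2] at h
  have : S.phi1 y = inner2 g (nablaAlong g (E 0) (bivector g S.o S.L))
      (nablaAlong g (E 0) (bivector g S.o S.L)) y := by rw [hE.ell_eq]; rfl
  rw [this, h]; simp

/-- If `φ₂` vanishes, then the null congruence is free of expansion and twist. -/
lemma of_phi2_eq_zero (hE : IsAdaptedFrame S E lam) (hg : LorentzOn g S.V) (hy : y ∈ S.V)
    (h2 : S.phi2 y = 0) :
    (∀ i, connForm g E 0 1 i y = inner1 g (connForm g E 0 1) S.x y / S.lx y * E 0 i y) ∧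
    (∀ i, connForm g E 0 2 i y = inner1 g (connForm g E 0 2) S.x y / S.lx y * E 0 i y) ∧
    inner1 g (connForm g E 0 0) (E 0) y = 0 ∧ inner1 g (connForm g E 1 2) (E 0) y = 0 := by
  have hE' := hE.toIsNullFrame
  obtain ⟨o1, o2, o3, o4, o5, o6⟩ := hE.toIsTypeNFrame.optical_scalars hg S.isOpen_V hy
  have hF2 : inner2 g S.F2 S.F2 y = 0 := by
    have h0 : ‖inner2 g S.F2 S.F2 y‖ + ‖inner2 g S.F2Star S.F2Star y‖ = 0 := h2
    have := norm_nonneg (inner2 g S.F2 S.F2 y)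
    have := norm_nonneg (inner2 g S.F2Star S.F2Star y)
    exact norm_eq_zero.1 (by linarith)
  have h := hE'.inner2_nablaAlong hg S.isOpen_V hy hE.L_eq hE.hodge_eq S.a
  have hF : inner2 g S.F2 S.F2 y = inner2 g (nablaAlong g S.a (bivector g S.o S.L))
      (nablaAlong g S.a (bivector g S.o S.L)) y := rfl
  rw [← hF, hF2] at h
  have h3 := congrArg Complex.re (pow_eq_zero_iff (two_ne_zero)|>.1 (neg_eq_zero.1 h.symm))
  simp only [Complex.sub_re, Complex.mul_re, Complex.I_re, Complex.I_im, Complex.ofReal_re,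
    Complex.ofReal_im, Complex.zero_re] at h3
  have haa : inner1 g (connForm g E 0 1) (connForm g E 0 1) y = 0 := by
    rw [inner1_congr (fun _ => rfl) (fun i => hE.a_eq hg hy i)] at h3
    linarith
  rw [hE'.inner1_self hy _ o1] at haa
  have he : inner1 g (connForm g E 0 1) (E 1) y = 0 := by nlinarith
  have hf : inner1 g (connForm g E 0 1) (E 2) y = 0 := by nlinarith
  have key : ∀ v : Tensor1 ℝ, inner1 g v (E 0) y = 0 → inner1 g v (E 1) y = 0 →
      inner1 g v (E 2) y = 0 → ∀ i, v i y = inner1 g v S.x y / S.lx y * E 0 i y := by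
    intro v v0 v1 v2 i
    have hv : ∀ j, v j y = - inner1 g v (E 3) y * E 0 j y := fun j => by
      rw [hE'.expand_inner1 hy v j, v0, v1, v2]; ring
    have hx : inner1 g v S.x y = - inner1 g v (E 3) y * S.lx y := by
      rw [inner1_congr (v' := fun j _ => - inner1 g v (E 3) y * E 0 j y) (w' := S.x) hv
        (fun _ => rfl), ← hE.lx_eq]
      exact dot_smul_left _ _ _
    rw [hv i, hx, mul_div_cancel_right₀ _ (hE.lx_ne y hy)]
  exact ⟨key _ o1 he hf, key _ o2 (by linarith) (by linarith), by linarith, by linarith⟩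

/-- Without expansion and twist, `dℓ` is the product of `ℓ` and a covector orthogonal to it. -/
lemma phi3_eq_zero (hE : IsAdaptedFrame S E lam) (hg : LorentzOn g S.V) (hy : y ∈ S.V)
    (h2 : S.phi2 y = 0) : S.phi3 y = 0 := by
  have hE' := hE.toIsNullFrame
  obtain ⟨ha, ha', hθ, -⟩ := hE.of_phi2_eq_zero hg hy h2
  obtain ⟨T, hT, hTs⟩ := hE'.exists_pd_frame hg S.isOpen_V hy
  set α := inner1 g (connForm g E 0 1) S.x y / S.lx y
  set α' := inner1 g (connForm g E 0 2) S.x y / S.lx y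
  let u : Tensor1 ℝ := fun i z => connForm g E 0 0 i z - α * E 1 i z - α' * E 2 i z
  have hF : ∀ i j, S.F3 i j y = wedge u (E 0) i j y := by
    intro i j
    simp only [FundamentalData.F3, ← hE.ell_eq, extDeriv1, hT, Fin.sum_univ_four, ha, ha',
      (hE'.connForm_relations hg S.isOpen_V hy).1, hTs 0 j i, wedge, u]
    ring
  have hu : inner1 g u (E 0) y = inner1 g (connForm g E 0 0) (E 0) y
      - α * inner1 g (E 1) (E 0) y - α' * inner1 g (E 2) (E 0) y := by
    simp only [inner1, u, Finset.mul_sum, ← Finset.sum_sub_distrib]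
    exact Finset.sum_congr rfl fun i _ => Finset.sum_congr rfl fun j _ => by ring
  rw [FundamentalData.phi3, inner2_congr hF hF, inner2_wedge, hu, hθ, hE.gram y hy, hE.gram y hy,
    hE.gram y hy]
  simp [nullGram]

/-- Without expansion and twist, `c` is orthogonal to `ℓ`. -/
lemma phi4_eq_zero (hE : IsAdaptedFrame S E lam) (hg : LorentzOn g S.V) (hy : y ∈ S.V)
    (h2 : S.phi2 y = 0) : S.phi4 y = 0 := by
  obtain ⟨-, -, -, hω⟩ := hE.of_phi2_eq_zero hg hy h2
  have hc : inner1 g S.c (E 0) y = - inner1 g (connForm g E 1 2) (E 0) y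
      - inner1 g (connForm g E 0 1) S.x y / S.lx y * inner1 g (E 2) (E 0) y
      + inner1 g (connForm g E 0 2) S.x y / S.lx y * inner1 g (E 1) (E 0) y := by
    have hv : (fun i => S.c i y) = - (fun i => connForm g E 1 2 i y)
        - (inner1 g (connForm g E 0 1) S.x y / S.lx y) • (fun i => E 2 i y)
        + (inner1 g (connForm g E 0 2) S.x y / S.lx y) • (fun i => E 1 i y) :=
      funext fun j => hE.c_eq hg hy j
    rw [inner1_eq_dot, hv]
    simp only [dot_sub_left, dot_add_left, dot_smul_left, dot_neg_left]
    rfl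
  have h0 : inner1 g S.ℓ S.c y = 0 := by
    rw [← hE.ell_eq]
    refine (hg.dot_comm hy _ _).trans (hc.trans ?_)
    rw [hω, hE.gram y hy, hE.gram y hy]
    simp [nullGram]
  have hll : inner1 g S.ℓ S.ℓ y = 0 := by
    rw [← hE.ell_eq, hE.gram y hy]; simp [nullGram]
  rw [FundamentalData.phi4, FundamentalData.F4, inner2_wedge, hll, h0]
  ring

lemma smooth_lx (hg : LorentzOn g S.V) : ContDiffOn ℝ ∞ S.lx S.V :=
  contDiffOn_inner1 hg S.smooth_ℓ S.smooth_x

lemma smooth_coeff (hE : IsAdaptedFrame S E lam) (hg : LorentzOn g S.V) (b : Fin 4) :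
    ContDiffOn ℝ ∞ (fun z => inner1 g (connForm g E 0 b) S.x z / S.lx z) S.V :=
  (contDiffOn_inner1 hg (fun i => hE.toIsNullFrame.smooth_connForm hg S.isOpen_V 0 b i)
    S.smooth_x).div (smooth_lx hg) hE.lx_ne

/-- A covector whose exterior product with `ℓ` vanishes is a multiple of `ℓ`. -/
lemma exists_multiple (hE : IsAdaptedFrame S E lam) (hy : y ∈ S.V) {v : Fin 4 → ℝ}
    (hv : ∀ m i, v m * E 0 i y = v i * E 0 m y) : ∃ s, ∀ m, v m = s * E 0 m y := by
  refine ⟨(∑ i, v i * up g S.x i y) / S.lx y, fun m => ?_⟩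
  have h : ∑ i, v m * E 0 i y * up g S.x i y = ∑ i, v i * E 0 m y * up g S.x i y :=
    Finset.sum_congr rfl fun i _ => by rw [hv]
  have hlx : ∑ i, E 0 i y * up g S.x i y = S.lx y := by
    rw [← hE.lx_eq]; exact (dot_eq_sum_mul_sharp _ _).symm
  have h1 : ∑ i, v m * E 0 i y * up g S.x i y = v m * S.lx y := by
    rw [← hlx, Finset.mul_sum]
    exact Finset.sum_congr rfl fun i _ => by ring
  have h2 : ∑ i, v i * E 0 m y * up g S.x i y = (∑ i, v i * up g S.x i y) * E 0 m y := by
    rw [Finset.sum_mul]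
    exact Finset.sum_congr rfl fun i _ => by ring
  have := hE.lx_ne y hy
  rw [h1, h2] at h
  field_simp
  linarith

/-- The derivative of `α` modulo `ℓ`, from the curvature form of the pair `(ℓ, e)`. -/
lemma pd_alpha (hE : IsAdaptedFrame S E lam) (hg : LorentzOn g S.V) (hy : y ∈ S.V)
    (h2 : ∀ z ∈ S.V, S.phi2 z = 0) {α α' : Coord → ℝ}
    (hα : α = fun z => inner1 g (connForm g E 0 1) S.x z / S.lx z)
    (hα' : α' = fun z => inner1 g (connForm g E 0 2) S.x z / S.lx z) :
    ∃ s, ∀ m, pd m α y = (α y ^ 2 + lam) * E 1 m y + α y * α' y * E 2 m y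
      + α' y * connForm g E 1 2 m y + s * E 0 m y := by
  have hE' := hE.toIsNullFrame
  have dα : DifferentiableAt ℝ α y :=
    differentiableAt_of_smooth S.isOpen_V (hα ▸ hE.smooth_coeff hg 1) hy
  have dE : ∀ a i, DifferentiableAt ℝ (E a i) y := fun a i =>
    differentiableAt_of_smooth S.isOpen_V (hE.smooth a i) hy
  have e1 : ∀ z ∈ S.V, ∀ i, connForm g E 0 1 i z = α z * E 0 i z := fun z hz i => by
    rw [hα]; exact (hE.of_phi2_eq_zero hg hz (h2 z hz)).1 i
  have e2 : ∀ z ∈ S.V, ∀ i, connForm g E 0 2 i z = α' z * E 0 i z := fun z hz i => by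
    rw [hα']; exact (hE.of_phi2_eq_zero hg hz (h2 z hz)).2.1 i
  obtain ⟨T, hT, hTs⟩ := hE'.exists_pd_frame hg S.isOpen_V hy
  obtain ⟨c03, c11, -, -, -, -, c21, -, -, -⟩ := hE'.connForm_relations hg S.isOpen_V hy
  obtain ⟨s, hs⟩ := hE.exists_multiple hy (v := fun m => pd m α y - ((α y ^ 2 + lam) * E 1 m y
      + α y * α' y * E 2 m y + α' y * connForm g E 1 2 m y)) (by
    intro m i
    have hc := hE.toIsTypeNFrame.curvForm_eq hg S.isOpen_V hy 0 1 m i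
    have hp : ∀ m i, pd m (connForm g E 0 1 i) y = pd m α y * E 0 i y + α y * pd m (E 0 i) y :=
      fun m i => by rw [pd_congr S.isOpen_V hy (fun z hz => e1 z hz i), pd_mul dα (dE 0 i)]
    simp only [curvForm, hp, hT, Fin.sum_univ_four, e1 y hy, e2 y hy, c03, c11, c21,
      hTs 0 i m] at hc
    simp [nullGram, coframe] at hc
    linear_combination hc)
  exact ⟨s, fun m => by linarith [hs m]⟩

/-- The derivative of `α'` modulo `ℓ`, from the curvature form of the pair `(ℓ, f)`. -/
lemma pd_alpha' (hE : IsAdaptedFrame S E lam) (hg : LorentzOn g S.V) (hy : y ∈ S.V)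
    (h2 : ∀ z ∈ S.V, S.phi2 z = 0) {α α' : Coord → ℝ}
    (hα : α = fun z => inner1 g (connForm g E 0 1) S.x z / S.lx z)
    (hα' : α' = fun z => inner1 g (connForm g E 0 2) S.x z / S.lx z) :
    ∃ s, ∀ m, pd m α' y = α y * α' y * E 1 m y + (α' y ^ 2 + lam) * E 2 m y
      - α y * connForm g E 1 2 m y + s * E 0 m y := by
  have hE' := hE.toIsNullFrame
  have dα : DifferentiableAt ℝ α' y :=
    differentiableAt_of_smooth S.isOpen_V (hα' ▸ hE.smooth_coeff hg 2) hy
  have dE : ∀ a i, DifferentiableAt ℝ (E a i) y := fun a i =>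
    differentiableAt_of_smooth S.isOpen_V (hE.smooth a i) hy
  have e1 : ∀ z ∈ S.V, ∀ i, connForm g E 0 1 i z = α z * E 0 i z := fun z hz i => by
    rw [hα]; exact (hE.of_phi2_eq_zero hg hz (h2 z hz)).1 i
  have e2 : ∀ z ∈ S.V, ∀ i, connForm g E 0 2 i z = α' z * E 0 i z := fun z hz i => by
    rw [hα']; exact (hE.of_phi2_eq_zero hg hz (h2 z hz)).2.1 i
  obtain ⟨T, hT, hTs⟩ := hE'.exists_pd_frame hg S.isOpen_V hy
  obtain ⟨c03, -, c22, -, -, -, -, -, -, -⟩ := hE'.connForm_relations hg S.isOpen_V hy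
  obtain ⟨s, hs⟩ := hE.exists_multiple hy (v := fun m => pd m α' y - (α y * α' y * E 1 m y
      + (α' y ^ 2 + lam) * E 2 m y - α y * connForm g E 1 2 m y)) (by
    intro m i
    have hc := hE.toIsTypeNFrame.curvForm_eq hg S.isOpen_V hy 0 2 m i
    have hp : ∀ m i, pd m (connForm g E 0 2 i) y
        = pd m α' y * E 0 i y + α' y * pd m (E 0 i) y :=
      fun m i => by rw [pd_congr S.isOpen_V hy (fun z hz => e2 z hz i), pd_mul dα (dE 0 i)]
    simp only [curvForm, hp, hT, Fin.sum_univ_four, e1 y hy, e2 y hy, c03, c22,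
      hTs 0 i m] at hc
    simp [nullGram, coframe] at hc
    linear_combination hc)
  exact ⟨s, fun m => by linarith [hs m]⟩

/-- If `φ₂ = 0` identically, then `φ₅ = - (α² + α*² + lam)²`, where the Ricci tensor is
`3 lam g`: `db` is `(α² + α*² + lam) ℓ ∧ n` up to the terms `ℓ ∧ e` and `ℓ ∧ f`. -/
lemma phi5_eq (hE : IsAdaptedFrame S E lam) (hg : LorentzOn g S.V) (hy : y ∈ S.V)
    (h2 : ∀ z ∈ S.V, S.phi2 z = 0) :
    S.phi5 y = - ((inner1 g (connForm g E 0 1) S.x y / S.lx y) ^ 2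
      + (inner1 g (connForm g E 0 2) S.x y / S.lx y) ^ 2 + lam) ^ 2 := by
  have hE' := hE.toIsNullFrame
  obtain ⟨α, hα⟩ : ∃ α : Coord → ℝ,
    α = fun z => inner1 g (connForm g E 0 1) S.x z / S.lx z := ⟨_, rfl⟩
  obtain ⟨α', hα'⟩ : ∃ α' : Coord → ℝ,
    α' = fun z => inner1 g (connForm g E 0 2) S.x z / S.lx z := ⟨_, rfl⟩
  obtain ⟨s, hs⟩ := hE.pd_alpha hg hy h2 hα hα'
  obtain ⟨s', hs'⟩ := hE.pd_alpha' hg hy h2 hα hα'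
  have dα : DifferentiableAt ℝ α y :=
    differentiableAt_of_smooth S.isOpen_V (hα ▸ hE.smooth_coeff hg 1) hy
  have dα' : DifferentiableAt ℝ α' y :=
    differentiableAt_of_smooth S.isOpen_V (hα' ▸ hE.smooth_coeff hg 2) hy
  have dE : ∀ a i, DifferentiableAt ℝ (E a i) y := fun a i =>
    differentiableAt_of_smooth S.isOpen_V (hE.smooth a i) hy
  have dθ : ∀ i, DifferentiableAt ℝ (connForm g E 0 0 i) y := fun i =>
    differentiableAt_of_smooth S.isOpen_V (hE'.smooth_connForm hg S.isOpen_V 0 0 i) hy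
  have hb : ∀ z ∈ S.V, ∀ i, S.b i z = (connForm g E 0 0 i z + α z * E 1 i z) + α' z * E 2 i z :=
    fun z hz i => by rw [hα, hα']; exact hE.b_eq hg hz i
  have hpb : ∀ m i, pd m (S.b i) y = (pd m (connForm g E 0 0 i) y
      + (pd m α y * E 1 i y + α y * pd m (E 1 i) y))
      + (pd m α' y * E 2 i y + α' y * pd m (E 2 i) y) := fun m i => by
    rw [pd_congr S.isOpen_V hy (fun z hz => hb z hz i),
      pd_add ((dθ i).fun_add (dα.fun_mul (dE 1 i))) (dα'.fun_mul (dE 2 i)),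
      pd_add (dθ i) (dα.fun_mul (dE 1 i)), pd_mul dα (dE 1 i), pd_mul dα' (dE 2 i)]
  have e1 : ∀ i, connForm g E 0 1 i y = α y * E 0 i y := by
    rw [hα]; exact (hE.of_phi2_eq_zero hg hy (h2 y hy)).1
  have e2 : ∀ i, connForm g E 0 2 i y = α' y * E 0 i y := by
    rw [hα']; exact (hE.of_phi2_eq_zero hg hy (h2 y hy)).2.1
  obtain ⟨T, hT, hTs⟩ := hE'.exists_pd_frame hg S.isOpen_V hy
  obtain ⟨c03, c11, c22, c30, c13, c23, c21, -, -, -⟩ := hE'.connForm_relations hg S.isOpen_V hy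
  -- `db = K ℓ ∧ n + s ℓ ∧ e + s' ℓ ∧ f`
  let G : Tensor2 ℝ := fun m i z => ((α z ^ 2 + α' z ^ 2 + lam) * wedge (E 0) (E 3) m i z
      + s * wedge (E 0) (E 1) m i z) + s' * wedge (E 0) (E 2) m i z
  have hF : ∀ m i, S.F5 m i y = G m i y := by
    intro m i
    simp only [G]
    have hc := hE.toIsTypeNFrame.curvForm_eq hg S.isOpen_V hy 0 0 m i
    simp only [curvForm, Fin.sum_univ_four, e1, e2, c03] at hc
    simp [nullGram, coframe] at hc
    simp only [FundamentalData.F5, extDeriv1, hpb, hs, hs', hT, Fin.sum_univ_four, c11, c22, c13,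
      c23, c21, hTs _ i m, e1, e2, wedge]
    linear_combination hc
  have hw : ∀ a b c d, inner2 g (fun i j z => wedge (E a) (E b) i j z)
      (fun i j z => wedge (E c) (E d) i j z) y
      = nullGram a c * nullGram b d - nullGram a d * nullGram b c := fun a b c d => by
    have := inner2_wedge (g := g) (y := y) (E a) (E b) (E c) (E d)
    simpa only [hE.gram y hy] using this
  rw [FundamentalData.phi5, inner2_congr hF hF]
  simp only [G, inner2_add_left, inner2_add_right, inner2_smul_left (fun _ => s),
    inner2_smul_left (fun _ => s'), inner2_smul_right (fun _ => s), inner2_smul_right (fun _ => s'),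
    inner2_smul_left (fun z => α z ^ 2 + α' z ^ 2 + lam),
    inner2_smul_right (fun z => α z ^ 2 + α' z ^ 2 + lam), hw]
  simp [nullGram, hα, hα']
  ring

/-- If `φ₂ = 0` identically and `φ₅ = 0`, then the 1-form `f` is a multiple of `ℓ`. -/
lemma phi6_eq_zero (hE : IsAdaptedFrame S E lam) (hg : LorentzOn g S.V) (hy : y ∈ S.V)
    (h2 : ∀ z ∈ S.V, S.phi2 z = 0) (h5 : S.phi5 y = 0) (i : Fin 4) : S.phi6 i y = 0 := by
  obtain ⟨α, hα⟩ : ∃ α : Coord → ℝ,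
    α = fun z => inner1 g (connForm g E 0 1) S.x z / S.lx z := ⟨_, rfl⟩
  obtain ⟨α', hα'⟩ : ∃ α' : Coord → ℝ,
    α' = fun z => inner1 g (connForm g E 0 2) S.x z / S.lx z := ⟨_, rfl⟩
  obtain ⟨s, hs⟩ := hE.pd_alpha hg hy h2 hα hα'
  have hK : α y ^ 2 + α' y ^ 2 + lam = 0 := by
    rw [hE.phi5_eq hg hy h2] at h5
    rw [hα, hα']
    exact pow_eq_zero_iff (two_ne_zero) |>.1 (neg_eq_zero.1 h5)
  have h1 : ∀ z ∈ S.V, S.alpha z = α z := fun z hz => by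
    rw [hα, FundamentalData.alpha, inner1_congr (fun i => hE.a_eq hg hz i) (fun _ => rfl)]
  have h1' : S.alphaStar y = - α' y := by
    have : inner1 g S.aStar S.x y = - inner1 g (connForm g E 0 2) S.x y := by
      rw [inner1_congr (v' := fun i z => - connForm g E 0 2 i z) (w' := S.x)
        (fun i => hE.aStar_eq hg hy i) (fun _ => rfl)]
      exact dot_neg_left _ _
    rw [hα', FundamentalData.alphaStar, this, neg_div]
  have hc : ∀ m, S.c m y = - connForm g E 1 2 m y - α y * E 2 m y + α' y * E 1 m y := fun m => by
    rw [hα, hα']; exact hE.c_eq hg hy m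
  refine hodgeWedge3_eq_zero S.o S.fStar (s := s) (fun m => ?_) i
  rw [FundamentalData.f, pd_congr S.isOpen_V hy h1, hs, h1', hc, ← hE.ell_eq]
  linear_combination E 1 m y * hK

end IsAdaptedFrame
end Vanishing

/-! ### The Hodge dual of a decomposable 2-form -/

section HodgeDual

variable {g : Tensor2 ℝ} {U : Set Coord} {y : Coord}

lemma eps_swap_left (i j k l : Fin 4) : eps i j k l = - eps j i k l := by
  revert i j k l; decide

lemma eps_swap_right (i j k l : Fin 4) : eps i j k l = - eps i j l k := by
  revert i j k l; decide

lemma eps_swap_outer (i j k l : Fin 4) : eps i j k l = - eps i l k j := by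
  revert i j k l; decide

/-- The Levi-Civita symbol computes determinants. -/
lemma sum_eps (p q r s : Fin 4 → ℝ) :
    ∑ i, ∑ j, ∑ k, ∑ l, (eps i j k l : ℝ) * p i * q j * r k * s l
      = (Matrix.of ![p, q, r, s]).det := by
  have h2 : Int.sign 2 = 1 := rfl
  have h3 : Int.sign 3 = 1 := rfl
  simp [Matrix.det_succ_row_zero, Fin.sum_univ_succ, eps, Fin.succAbove, Matrix.submatrix, h2, h3]
  ring

lemma hodge_antisymm (o : ℝ) (F : Tensor2 ℝ) (i j : Fin 4) :
    hodge g o F i j y = - hodge g o F j i y := by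
  rw [hodge, hodge, ← mul_neg]
  refine congrArg (fun t => 1 / 2 * t) ?_
  simp only [← Finset.sum_neg_distrib]
  refine Finset.sum_congr rfl fun k _ => Finset.sum_congr rfl fun l _ =>
    Finset.sum_congr rfl fun m _ => Finset.sum_congr rfl fun n _ => ?_
  rw [vol, vol, eps_swap_left i j k l]
  push_cast; ring

lemma hodge_of_eq_wedge (o : ℝ) {F : Tensor2 ℝ} {u v : Tensor1 ℝ}
    (hF : ∀ i j, F i j y = wedge u v i j y) (i j : Fin 4) :
    hodge g o F i j y = ∑ k, ∑ l, vol g o i j k l y * up g u k y * up g v l y := by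
  have h1 : hodge g o F i j y = 1 / 2 * (∑ k, ∑ l, vol g o i j k l y * up g u k y * up g v l y
      - ∑ k, ∑ l, vol g o i j k l y * up g v k y * up g u l y) := by
    simp only [hodge, hF, wedge, up, ← Finset.sum_sub_distrib]
    refine congrArg (fun t => 1 / 2 * t) ?_
    refine Finset.sum_congr rfl fun k _ => Finset.sum_congr rfl fun l _ => ?_
    simp only [Fin.sum_univ_four]
    ring
  have h2 : ∑ k, ∑ l, vol g o i j k l y * up g v k y * up g u l y
      = - ∑ k, ∑ l, vol g o i j k l y * up g u k y * up g v l y := by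
    rw [Finset.sum_comm]
    simp only [← Finset.sum_neg_distrib]
    refine Finset.sum_congr rfl fun k _ => Finset.sum_congr rfl fun l _ => ?_
    rw [vol, vol, eps_swap_right i j l k]
    push_cast; ring
  rw [h1, h2]; ring

lemma sum_hodge_up_right (o : ℝ) {F : Tensor2 ℝ} {u v : Tensor1 ℝ}
    (hF : ∀ i j, F i j y = wedge u v i j y) (i : Fin 4) :
    ∑ j, hodge g o F i j y * up g v j y = 0 := by
  have h : ∑ j, hodge g o F i j y * up g v j y
      = ∑ j, ∑ k, ∑ l, vol g o i j k l y * up g v j y * up g u k y * up g v l y := by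
    simp only [hodge_of_eq_wedge o hF, Finset.sum_mul]
    exact Finset.sum_congr rfl fun j _ => Finset.sum_congr rfl fun k _ =>
      Finset.sum_congr rfl fun l _ => by ring
  have hneg : ∑ j, ∑ k, ∑ l, vol g o i j k l y * up g v j y * up g u k y * up g v l y
      = - ∑ j, ∑ k, ∑ l, vol g o i j k l y * up g v j y * up g u k y * up g v l y := by
    calc _ = ∑ l, ∑ k, ∑ j, vol g o i j k l y * up g v j y * up g u k y * up g v l y := by
          rw [Finset.sum_congr rfl fun j _ => Finset.sum_comm, Finset.sum_comm]
          exact Finset.sum_congr rfl fun l _ => Finset.sum_comm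
      _ = _ := by
          simp only [← Finset.sum_neg_distrib]
          refine Finset.sum_congr rfl fun j _ => Finset.sum_congr rfl fun k _ =>
            Finset.sum_congr rfl fun l _ => ?_
          rw [vol, vol, eps_swap_outer i l k j]
          push_cast; ring
  rw [h]; linarith

/-- The products of the components of the vector `*(x ∧ u ∧ v)`, from the determinant of the
metric in the basis consisting of a coordinate vector and `x, u, v`. -/
lemma LorentzOn.sum_hodge_mul (hg : LorentzOn g U) (hy : y ∈ U) {o : ℝ} (ho : o = 1 ∨ o = -1)
    {F : Tensor2 ℝ} {u v x : Tensor1 ℝ} (hF : ∀ i j, F i j y = wedge u v i j y)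
    (huu : inner1 g u u y = 0) (huv : inner1 g u v y = 0) (hvv : inner1 g v v y = 1)
    (hvx : inner1 g v x y = 0) (i j : Fin 4) :
    (∑ k, hodge g o F i k y * up g x k y) * (∑ k, hodge g o F j k y * up g x k y)
      = inner1 g u x y ^ 2 * g i j y
        - inner1 g u x y * (x i y * u j y + u i y * x j y) + inner1 g x x y * u i y * u j y
        - inner1 g u x y ^ 2 * v i y * v j y := by
  let M : Fin 4 → Matrix (Fin 4) (Fin 4) ℝ := fun i =>
    Matrix.of ![Pi.single i 1, fun k => up g x k y, fun k => up g u k y, fun k => up g v k y]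
  have h1 : ∀ i, ∑ k, hodge g o F i k y * up g x k y
      = o * √|(metricMatrix g y).det| * (M i).det := by
    intro i
    have hM : (M i).det
        = ∑ j, ∑ k, ∑ l, (eps i j k l : ℝ) * up g x j y * up g u k y * up g v l y := by
      rw [← sum_eps, Finset.sum_eq_single_of_mem i (Finset.mem_univ i)
        (fun b _ hb => by simp [hb])]
      simp
    simp only [hM, hodge_of_eq_wedge o hF, vol, Finset.sum_mul, Finset.mul_sum]
    exact Finset.sum_congr rfl fun j _ => Finset.sum_congr rfl fun k _ =>
      Finset.sum_congr rfl fun l _ => by ring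
  have h2 : (M i).det * (metricMatrix g y).det * (M j).det
      = (M i * metricMatrix g y * (M j).transpose).det := by
    rw [Matrix.det_mul, Matrix.det_mul, Matrix.det_transpose]
  have hs : ∀ v : Tensor1 ℝ, ∀ i, ∑ k, g i k y * up g v k y = v i y := fun v i =>
    hg.sum_g_sharp hy (fun j => v j y) i
  have hs' : ∀ v : Tensor1 ℝ, ∀ i, ∑ k, up g v k y * g k i y = v i y := fun v i => by
    rw [← hs v i]
    exact Finset.sum_congr rfl fun k _ => by rw [hg.symm y hy k i]; ring
  have hup : ∀ v w : Tensor1 ℝ, ∑ k, v k y * up g w k y = inner1 g v w y := fun v w =>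
    (dot_eq_sum_mul_sharp _ _).symm
  have hc : ∀ v w : Tensor1 ℝ, inner1 g v w y = inner1 g w v y := fun v w => hg.dot_comm hy _ _
  have h3 : M i * metricMatrix g y * (M j).transpose
      = !![g i j y, x i y, u i y, v i y;
          x j y, inner1 g x x y, inner1 g u x y, 0;
          u j y, inner1 g u x y, 0, 0;
          v j y, 0, 0, 1] := by
    have r0 : ∀ k, (M i * metricMatrix g y) 0 k = g i k y := fun k => by
      simp [M, Matrix.mul_apply, metricMatrix, Pi.single_apply]
    have r1 : ∀ k, (M i * metricMatrix g y) 1 k = x k y := fun k => by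
      rw [Matrix.mul_apply]; exact hs' x k
    have r2 : ∀ k, (M i * metricMatrix g y) 2 k = u k y := fun k => by
      rw [Matrix.mul_apply]; exact hs' u k
    have r3 : ∀ k, (M i * metricMatrix g y) 3 k = v k y := fun k => by
      rw [Matrix.mul_apply]; exact hs' v k
    have t0 : ∀ k, M j 0 k = (Pi.single j 1 : Fin 4 → ℝ) k := fun k => rfl
    have t1 : ∀ k, M j 1 k = up g x k y := fun k => rfl
    have t2 : ∀ k, M j 2 k = up g u k y := fun k => rfl
    have t3 : ∀ k, M j 3 k = up g v k y := fun k => rfl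
    ext a b
    rw [Matrix.mul_apply]
    fin_cases a <;> fin_cases b <;>
      simp [r0, r1, r2, r3, t0, t1, t2, t3, hs, hup, huu, huv, hvv, hvx, hc x u, hc x v, hc v u,
        Pi.single_apply]
  have hdet : √|(metricMatrix g y).det| * √|(metricMatrix g y).det| = - (metricMatrix g y).det := by
    rw [Real.mul_self_sqrt (abs_nonneg _), abs_of_neg (hg.det_neg hy)]
  have hoo : o * o = 1 := by rcases ho with h | h <;> rw [h] <;> norm_num
  rw [h3] at h2
  have h4 : (∑ k, hodge g o F i k y * up g x k y) * (∑ k, hodge g o F j k y * up g x k y)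
      = - ((M i).det * (metricMatrix g y).det * (M j).det) := by
    rw [h1, h1]
    linear_combination (o * o * (M i).det * (M j).det) * hdet
      - ((M i).det * (metricMatrix g y).det * (M j).det) * hoo
  rw [h4, h2]
  simp [Matrix.det_succ_row_zero, Fin.sum_univ_succ, Fin.succAbove, Matrix.submatrix]
  ring

end HodgeDual

/-! ### Construction of the adapted frame -/

section Construction

variable {g : Tensor2 ℝ} {U : Set Coord} {y : Coord} {Λ : ℝ}

namespace FundamentalData

/-- The null frame determined by fundamental data: `e` and `f` are the contractions of `L` and `*L`
with the auxiliary vector field `x`, normalised, and `n` is the null vector with `(ℓ, n) = -1` in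
the plane of `ℓ` and `x`. -/
def nullFrame (S : FundamentalData U g) : Fin 4 → Tensor1 ℝ :=
  ![S.ℓ, fun i y => - (1 / S.lx y) * ∑ j, S.L i j y * up g S.x j y,
    fun i y => - (1 / S.lx y) * ∑ j, hodge g S.o S.L i j y * up g S.x j y,
    fun i y => - (1 / S.lx y) * (S.x i y - inner1 g S.x S.x y / (2 * S.lx y) * S.ℓ i y)]

variable {S : FundamentalData U g}

/-- The Weyl tensor in terms of the fundamental 2-form. -/
lemma weyl_eq_wedge (hy : y ∈ S.V) (i j k l : Fin 4) :
    weyl g i j k l y = S.L i j y * S.L k l y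
      - hodge g S.o S.L i j y * hodge g S.o S.L k l y := by
  have h := congrArg Complex.re (S.weyl_eq y hy i j k l)
  have hs : √2 * √2 = (2 : ℝ) := Real.mul_self_sqrt (by norm_num)
  simp only [selfDualWeyl, bivector] at h
  simp at h
  linear_combination 2 * h + 1 / 2 * (S.L i j y * S.L k l y
      - hodge g S.o S.L i j y * hodge g S.o S.L k l y) * hs

lemma ell_ne_zero (hW : ∃ i j k l, weyl g i j k l y ≠ 0) (hy : y ∈ S.V) :
    (fun i => S.ℓ i y) ≠ 0 := by
  intro h0
  obtain ⟨-, -, -, e, -, -, hL⟩ := S.fundamental_ℓ y hy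
  have hL0 : ∀ i j, S.L i j y = 0 := fun i j => by
    have hℓ : ∀ i, S.ℓ i y = 0 := fun i => congrFun h0 i
    rw [hL, wedge, hℓ, hℓ]; ring
  have hH0 : ∀ i j, hodge g S.o S.L i j y = 0 := fun i j => by simp [hodge, hL0]
  obtain ⟨i, j, k, l, hw⟩ := hW
  exact hw (by rw [weyl_eq_wedge hy, hL0, hH0]; ring)

lemma lx_ne_zero (hg : LorentzOn g S.V) (hW : ∃ i j k l, weyl g i j k l y ≠ 0) (hy : y ∈ S.V) :
    S.lx y ≠ 0 := fun h =>
  ell_ne_zero hW hy (hg.eq_zero_of_null hy (S.fundamental_ℓ y hy).1 (S.timelike_x y hy) h)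

/-- The covector `e` of the null frame differs from any other unit covector with `L = ℓ ∧ e` by a
multiple of `ℓ`. -/
lemma frame_one_spec (hg : LorentzOn g S.V) (hy : y ∈ S.V) (hlx : S.lx y ≠ 0) :
    (∀ i j, S.L i j y = wedge S.ℓ (S.nullFrame 1) i j y) ∧
    inner1 g S.ℓ (S.nullFrame 1) y = 0 ∧ inner1 g (S.nullFrame 1) (S.nullFrame 1) y = 1 ∧
    inner1 g (S.nullFrame 1) S.x y = 0 := by
  obtain ⟨hll, -, -, e, hee, hle, hL⟩ := S.fundamental_ℓ y hy
  have he : ∀ i, S.nullFrame 1 i y = e i y - inner1 g e S.x y / S.lx y * S.ℓ i y := by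
    intro i
    have : ∑ j, S.L i j y * up g S.x j y = inner1 g e S.x y * S.ℓ i y - S.lx y * e i y := by
      have h1 : inner1 g e S.x y = ∑ j, e j y * up g S.x j y := dot_eq_sum_mul_sharp _ _
      have h2 : S.lx y = ∑ j, S.ℓ j y * up g S.x j y := dot_eq_sum_mul_sharp _ _
      rw [h1, h2, Finset.sum_mul, Finset.sum_mul, ← Finset.sum_sub_distrib]
      exact Finset.sum_congr rfl fun j _ => by rw [hL, wedge]; ring
    change - (1 / S.lx y) * ∑ j, S.L i j y * up g S.x j y = _
    rw [this]
    field_simp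
    ring
  have hv : (fun i => S.nullFrame 1 i y) = (fun i => e i y)
      - (inner1 g e S.x y / S.lx y) • (fun i => S.ℓ i y) := funext he
  have hll' : dot g y (fun i => S.ℓ i y) (fun i => S.ℓ i y) = 0 := hll
  have hle' : dot g y (fun i => S.ℓ i y) (fun i => e i y) = 0 := hle
  have hel' : dot g y (fun i => e i y) (fun i => S.ℓ i y) = 0 := by rw [hg.dot_comm hy]; exact hle
  have hee' : dot g y (fun i => e i y) (fun i => e i y) = 1 := hee
  refine ⟨fun i j => ?_, ?_, ?_, ?_⟩
  · rw [hL, wedge, wedge, he, he]; ring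
  · rw [inner1_eq_dot, hv]
    simp only [dot_sub_right, dot_smul_right, hll', hle']; ring
  · rw [inner1_eq_dot, hv]
    simp only [dot_sub_right, dot_smul_right, dot_sub_left, dot_smul_left, hll', hle', hel', hee']
    ring
  · rw [inner1_eq_dot, hv]
    simp only [dot_sub_left, dot_smul_left]
    change inner1 g e S.x y - inner1 g e S.x y / S.lx y * S.lx y = 0
    field_simp
    ring

/-- The covector `f` of the null frame is a space-like unit covector orthogonal to `ℓ`, `e`
and `x`. -/
lemma frame_two_spec (hg : LorentzOn g S.V) (hy : y ∈ S.V) (hlx : S.lx y ≠ 0) :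
    inner1 g (S.nullFrame 2) S.ℓ y = 0 ∧ inner1 g (S.nullFrame 2) (S.nullFrame 1) y = 0 ∧
    inner1 g (S.nullFrame 2) (S.nullFrame 2) y = 1 ∧ inner1 g (S.nullFrame 2) S.x y = 0 := by
  obtain ⟨hll, -, hNl, -⟩ := S.fundamental_ℓ y hy
  obtain ⟨hL, hle, hee, hex⟩ := frame_one_spec hg hy hlx
  have hNe := sum_hodge_up_right (g := g) S.o hL
  set v : Fin 4 → ℝ := fun i => ∑ j, hodge g S.o S.L i j y * up g S.x j y with hv
  have hf : (fun i => S.nullFrame 2 i y) = (- (1 / S.lx y)) • v := rfl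
  have hanti : ∀ p : Tensor1 ℝ, dot g y v (fun i => p i y)
      = - ∑ j, (∑ i, hodge g S.o S.L j i y * up g p i y) * up g S.x j y := by
    intro p
    rw [dot_eq_sum_mul_sharp]
    simp only [hv, Finset.sum_mul, ← Finset.sum_neg_distrib]
    rw [Finset.sum_comm]
    refine Finset.sum_congr rfl fun j _ => Finset.sum_congr rfl fun i _ => ?_
    rw [hodge_antisymm S.o S.L i j, up_eq_sharp p]; ring
  have vl : dot g y v (fun i => S.ℓ i y) = 0 := by rw [hanti]; simp [hNl]
  have ve : dot g y v (fun i => S.nullFrame 1 i y) = 0 := by rw [hanti]; simp [hNe]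
  have vx : dot g y v (fun i => S.x i y) = 0 := by
    have h1 := hanti S.x
    have h2 : ∑ j, (∑ i, hodge g S.o S.L j i y * up g S.x i y) * up g S.x j y
        = dot g y v (fun i => S.x i y) := (dot_eq_sum_mul_sharp _ _).symm
    linarith
  have vv : dot g y v v = S.lx y ^ 2 := by
    have h := fun i j => hg.sum_hodge_mul hy S.o_eq hL hll hle hee hex i j
    have h1 : dot g y v v = ∑ i, ∑ j, ginv g i j y * (v i * v j) := by
      simp only [dot]
      exact Finset.sum_congr rfl fun i _ => Finset.sum_congr rfl fun j _ => by ring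
    have hlxe : inner1 g S.ℓ S.x y = S.lx y := rfl
    simp only [hlxe] at h
    have h4 : ∑ i, ∑ j, ginv g i j y * g i j y = 4 := by
      have : ∀ i, ∑ j, ginv g i j y * g i j y = 1 := fun i => by
        have := hg.sum_ginv_g hy i i
        rw [if_pos rfl] at this
        rw [← this]
        exact Finset.sum_congr rfl fun j _ => by rw [hg.symm y hy i j]
      simp [this]
    have h5 : dot g y v v = S.lx y ^ 2 * (∑ i, ∑ j, ginv g i j y * g i j y)
        - S.lx y * (inner1 g S.x S.ℓ y + inner1 g S.ℓ S.x y)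
        + inner1 g S.x S.x y * inner1 g S.ℓ S.ℓ y
        - S.lx y ^ 2 * inner1 g (S.nullFrame 1) (S.nullFrame 1) y := by
      rw [h1]
      simp only [hv, h, inner1, Finset.mul_sum, ← Finset.sum_add_distrib,
        ← Finset.sum_sub_distrib]
      exact Finset.sum_congr rfl fun i _ => Finset.sum_congr rfl fun j _ => by ring
    have hc : inner1 g S.x S.ℓ y = S.lx y := hg.dot_comm hy _ _
    rw [h5, h4, hc, hlxe, hll, hee]; ring
  refine ⟨?_, ?_, ?_, ?_⟩
  · rw [inner1_eq_dot, hf, dot_smul_left, vl, mul_zero]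
  · rw [inner1_eq_dot, hf, dot_smul_left, ve, mul_zero]
  · rw [inner1_eq_dot, hf, dot_smul_left, dot_smul_right, vv]; field_simp
  · rw [inner1_eq_dot, hf, dot_smul_left, vx, mul_zero]

lemma smooth_hodge (hg : LorentzOn g S.V) (i j : Fin 4) :
    ContDiffOn ℝ ∞ (hodge g S.o S.L i j) S.V := by
  have hvol : ∀ i j k l, ContDiffOn ℝ ∞ (vol g S.o i j k l) S.V := by
    intro i j k l
    refine (contDiffOn_const.mul ?_).mul contDiffOn_const
    have hdet : ContDiffOn ℝ ∞ (fun y => - (metricMatrix g y).det) S.V :=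
      (contDiffOn_det hg.smooth).neg
    refine (hdet.sqrt fun y hy => ?_).congr fun y hy => ?_
    · have := hg.det_neg hy; linarith
    · rw [abs_of_neg (hg.det_neg hy)]
  refine contDiffOn_const.mul (ContDiffOn.sum fun k _ => ContDiffOn.sum fun l _ =>
    ContDiffOn.sum fun m _ => ContDiffOn.sum fun n _ => ?_)
  exact (((hvol i j k l).mul (hg.contDiffOn_ginv k m)).mul (hg.contDiffOn_ginv l n)).mul
    (S.smooth_L m n)

lemma isNullFrame (hg : LorentzOn g S.V) (hlx : ∀ y ∈ S.V, S.lx y ≠ 0) :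
    IsNullFrame g S.V S.nullFrame where
  smooth a i := by
    have hup : ∀ j, ContDiffOn ℝ ∞ (up g S.x j) S.V := fun j =>
      ContDiffOn.sum fun k _ => (hg.contDiffOn_ginv j k).mul (S.smooth_x k)
    have hsl : ContDiffOn ℝ ∞ S.lx S.V := contDiffOn_inner1 hg S.smooth_ℓ S.smooth_x
    have hinv : ContDiffOn ℝ ∞ (fun y => - (1 / S.lx y)) S.V :=
      (contDiffOn_const.div hsl hlx).neg
    fin_cases a
    · exact S.smooth_ℓ i
    · exact hinv.mul (ContDiffOn.sum fun j _ => (S.smooth_L i j).mul (hup j))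
    · exact hinv.mul (ContDiffOn.sum fun j _ => (smooth_hodge hg i j).mul (hup j))
    · refine hinv.mul ((S.smooth_x i).sub (ContDiffOn.mul ?_ (S.smooth_ℓ i)))
      exact (contDiffOn_inner1 hg S.smooth_x S.smooth_x).div (contDiffOn_const.mul hsl)
        fun y hy => mul_ne_zero two_ne_zero (hlx y hy)
  gram y hy a b := by
    have h0 := hlx y hy
    obtain ⟨hll, -⟩ := S.fundamental_ℓ y hy
    obtain ⟨-, hle, hee, hex⟩ := frame_one_spec hg hy h0
    obtain ⟨hfl, hfe, hff, hfx⟩ := frame_two_spec hg hy h0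
    have hn : (fun i => S.nullFrame 3 i y) = (- (1 / S.lx y)) • ((fun i => S.x i y)
      - (inner1 g S.x S.x y / (2 * S.lx y)) • (fun i => S.ℓ i y)) := rfl
    have hc : ∀ v w : Tensor1 ℝ, inner1 g v w y = inner1 g w v y := fun v w => hg.dot_comm hy _ _
    have hr : ∀ v : Tensor1 ℝ, inner1 g v (S.nullFrame 3) y = - (1 / S.lx y) * (inner1 g v S.x y
        - inner1 g S.x S.x y / (2 * S.lx y) * inner1 g v S.ℓ y) := fun v => by
      rw [inner1_eq_dot, hn, dot_smul_right, dot_sub_right, dot_smul_right]; rfl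
    have hlx' : inner1 g S.ℓ S.x y = S.lx y := rfl
    have n0 : inner1 g S.ℓ (S.nullFrame 3) y = -1 := by
      rw [hr, hll, hlx']; field_simp; ring
    have n1 : inner1 g (S.nullFrame 1) (S.nullFrame 3) y = 0 := by
      rw [hr, hex, hc _ S.ℓ, hle]; ring
    have n2 : inner1 g (S.nullFrame 2) (S.nullFrame 3) y = 0 := by
      rw [hr, hfx, hfl]; ring
    have n3 : inner1 g (S.nullFrame 3) (S.nullFrame 3) y = 0 := by
      rw [hr, hc _ S.x, hc _ S.ℓ, hr, n0, hc S.x S.ℓ, hlx']; field_simp; ring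
    have z : S.nullFrame 0 = S.ℓ := rfl
    have h10 := (hc (S.nullFrame 1) S.ℓ).trans hle
    have h02 := (hc S.ℓ (S.nullFrame 2)).trans hfl
    have h12 := (hc (S.nullFrame 1) (S.nullFrame 2)).trans hfe
    have h30 := (hc (S.nullFrame 3) S.ℓ).trans n0
    have h31 := (hc (S.nullFrame 3) (S.nullFrame 1)).trans n1
    have h32 := (hc (S.nullFrame 3) (S.nullFrame 2)).trans n2
    fin_cases a <;> fin_cases b <;> simp [nullGram, z, hll, hle, hee, hfl, hfe, hff,
      n0, n1, n2, n3, h10, h02, h12, h30, h31, h32]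

/-- The dual of the fundamental 2-form is `ℓ ∧ f`. -/
lemma hodge_eq_wedge (hg : LorentzOn g S.V) (hlx : ∀ y ∈ S.V, S.lx y ≠ 0) (hy : y ∈ S.V)
    (i j : Fin 4) : hodge g S.o S.L i j y = wedge S.ℓ (S.nullFrame 2) i j y := by
  have hE := isNullFrame hg hlx
  obtain ⟨-, -, hNl, -⟩ := S.fundamental_ℓ y hy
  obtain ⟨hL, -⟩ := frame_one_spec hg hy (hlx y hy)
  obtain ⟨hfl, -, hff, -⟩ := frame_two_spec hg hy (hlx y hy)
  have hNe := sum_hodge_up_right (g := g) S.o hL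
  set N : Fin 4 → Fin 4 → ℝ := fun i j => hodge g S.o S.L i j y with hN
  have hanti : ∀ i j, N i j = - N j i := fun i j => hodge_antisymm S.o S.L i j
  set w : Fin 4 → ℝ := fun i => ∑ k, N i k * up g (S.nullFrame 2) k y with hw
  have hlx0 := hlx y hy
  have hup3 : ∀ k, up g (S.nullFrame 3) k y = - (1 / S.lx y) * (up g S.x k y
      - inner1 g S.x S.x y / (2 * S.lx y) * up g S.ℓ k y) := by
    intro k
    have : ∀ j, S.nullFrame 3 j y = - (1 / S.lx y) * (S.x j y
      - inner1 g S.x S.x y / (2 * S.lx y) * S.ℓ j y) := fun j => rfl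
    simp only [up, this, Finset.mul_sum, ← Finset.sum_sub_distrib]
    exact Finset.sum_congr rfl fun j _ => by ring
  have hNn : ∀ i, ∑ k, N i k * up g (S.nullFrame 3) k y = S.nullFrame 2 i y := by
    intro i
    have h1 : ∑ k, N i k * up g (S.nullFrame 3) k y = - (1 / S.lx y) *
        ((∑ k, N i k * up g S.x k y) - inner1 g S.x S.x y / (2 * S.lx y)
          * ∑ k, N i k * up g S.ℓ k y) := by
      simp only [hup3, Finset.mul_sum, ← Finset.sum_sub_distrib]
      exact Finset.sum_congr rfl fun k _ => by ring
    rw [h1, hNl i, mul_zero, sub_zero]; rfl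
  -- the expansion of the second index in the null frame
  have hexp : ∀ i j, N i j = - S.nullFrame 2 i y * S.ℓ j y + w i * S.nullFrame 2 j y := by
    intro i j
    have h1 : N i j = ∑ b, (∑ k, N i k * up g (coframe S.nullFrame b) k y)
        * S.nullFrame b j y := by
      simp only [Finset.sum_mul]
      rw [Finset.sum_comm]
      simp only [mul_assoc, ← Finset.mul_sum, hE.completeness hy]
      simp
    have hup : ∀ v : Tensor1 ℝ, ∀ k, up g (fun i y => - v i y) k y = - up g v k y := fun v k => by
      simp [up]
    have u0 : ∀ k, up g (coframe S.nullFrame 0) k y = - up g (S.nullFrame 3) k y :=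
      fun k => hup _ k
    have u3 : ∀ k, up g (coframe S.nullFrame 3) k y = - up g S.ℓ k y := fun k => hup _ k
    have u1 : ∀ k, up g (coframe S.nullFrame 1) k y = up g (S.nullFrame 1) k y := fun k => rfl
    have u2 : ∀ k, up g (coframe S.nullFrame 2) k y = up g (S.nullFrame 2) k y := fun k => rfl
    rw [h1, Fin.sum_univ_four]
    simp only [u0, u1, u2, u3, mul_neg, Finset.sum_neg_distrib, hNn]
    rw [hNl i, hNe i]
    change - S.nullFrame 2 i y * S.ℓ j y + _ + w i * _ + _ = _
    ring
  have hff' : ∑ j, S.nullFrame 2 j y * up g (S.nullFrame 2) j y = 1 := by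
    rw [← hff]; exact (dot_eq_sum_mul_sharp _ _).symm
  have hlf' : ∑ j, S.ℓ j y * up g (S.nullFrame 2) j y = 0 := by
    rw [← hfl]; exact (dot_eq_sum_mul_sharp _ _).symm.trans (hg.dot_comm hy _ _)
  have hwf : ∑ i, w i * up g (S.nullFrame 2) i y = 0 := by
    have h1 : ∑ i, w i * up g (S.nullFrame 2) i y
        = ∑ i, ∑ k, N i k * up g (S.nullFrame 2) k y * up g (S.nullFrame 2) i y := by
      simp only [hw, Finset.sum_mul]
    have h2 : ∑ i, ∑ k, N i k * up g (S.nullFrame 2) k y * up g (S.nullFrame 2) i y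
        = - ∑ i, ∑ k, N i k * up g (S.nullFrame 2) k y * up g (S.nullFrame 2) i y := by
      conv_lhs => rw [Finset.sum_comm]
      simp only [← Finset.sum_neg_distrib]
      exact Finset.sum_congr rfl fun i _ => Finset.sum_congr rfl fun k _ => by
        rw [hanti k i]; ring
    linarith
  have hwl : ∀ i, w i = S.ℓ i y := by
    intro i
    have h : ∀ j, w i * S.nullFrame 2 j y + w j * S.nullFrame 2 i y
        = S.nullFrame 2 j y * S.ℓ i y + S.nullFrame 2 i y * S.ℓ j y := fun j => by
      have := hanti i j
      rw [hexp i j, hexp j i] at this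
      linarith
    have h1 : w i * (∑ j, S.nullFrame 2 j y * up g (S.nullFrame 2) j y)
        + (∑ j, w j * up g (S.nullFrame 2) j y) * S.nullFrame 2 i y
        = (∑ j, S.nullFrame 2 j y * up g (S.nullFrame 2) j y) * S.ℓ i y
        + S.nullFrame 2 i y * ∑ j, S.ℓ j y * up g (S.nullFrame 2) j y := by
      simp only [Finset.mul_sum, Finset.sum_mul, ← Finset.sum_add_distrib]
      exact Finset.sum_congr rfl fun j _ => by
        linear_combination up g (S.nullFrame 2) j y * h j
    rw [hff', hwf, hlf'] at h1
    linarith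
  change N i j = _
  rw [hexp, hwl, wedge]; ring

/-- On an Einstein space with `6 Q = Λ g`, the null frame of fundamental data is adapted. -/
lemma isAdaptedFrame (hg : LorentzOn g S.V)
    (hQ : ∀ y ∈ S.V, ∀ i j, 6 * tensorQ g i j y = Λ * g i j y)
    (hW : ∀ y ∈ S.V, ∃ i j k l, weyl g i j k l y ≠ 0) :
    IsAdaptedFrame S S.nullFrame (Λ / 3) where
  toIsNullFrame := isNullFrame hg fun y hy => lx_ne_zero hg (hW y hy) hy
  ell_eq := rfl
  L_eq y hy := (frame_one_spec hg hy (lx_ne_zero hg (hW y hy) hy)).1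
  hodge_eq y hy := hodge_eq_wedge hg (fun y hy => lx_ne_zero hg (hW y hy) hy) hy
  e_x y hy := (frame_one_spec hg hy (lx_ne_zero hg (hW y hy) hy)).2.2.2
  f_x y hy := (frame_two_spec hg hy (lx_ne_zero hg (hW y hy) hy)).2.2.2
  lx_ne y hy := lx_ne_zero hg (hW y hy) hy
  riemann_eq y hy i j k l := by
    have hlx : ∀ y ∈ S.V, S.lx y ≠ 0 := fun y hy => lx_ne_zero hg (hW y hy) hy
    have h := weyl_eq_wedge hy i j k l
    rw [(frame_one_spec hg hy (hlx y hy)).1, (frame_one_spec hg hy (hlx y hy)).1,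
      hodge_eq_wedge hg hlx hy, hodge_eq_wedge hg hlx hy] at h
    have q : ∀ i j, tensorQ g i j y = Λ / 6 * g i j y := fun i j => by linarith [hQ y hy i j]
    simp only [weyl, q] at h
    change _ = wedge S.ℓ (S.nullFrame 1) i j y * wedge S.ℓ (S.nullFrame 1) k l y
      - wedge S.ℓ (S.nullFrame 2) i j y * wedge S.ℓ (S.nullFrame 2) k l y + _
    linear_combination h

end FundamentalData
end Construction

/-! ### Passage to the spacetime -/

section Spacetime

variable {M : Type*} [TopologicalSpace M] [ChartedSpace Coord M]

namespace LorentzMetric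

/-- The components of a Lorentzian metric in a chart are a Lorentzian metric on the coordinate
domain. -/
lemma lorentzOn_comp [IsManifold (𝓡 4) ∞ M] (g : LorentzMetric M)
    {φ : OpenPartialHomeomorph M Coord} (hφ : φ ∈ IsManifold.maximalAtlas (𝓡 4) ∞ M) :
    LorentzOn (g.comp φ) φ.target where
  smooth := g.smooth φ hφ
  symm y _ i j := g.symm _ _ _
  lorentz y hy := by
    have hmd : φ.symm.MDifferentiable (𝓡 4) (𝓡 4) := by
      refine ⟨?_, ?_⟩
      · exact (contMDiffOn_symm_of_mem_maximalAtlas hφ).mdifferentiableOn (by simp)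
      · exact (contMDiffOn_of_mem_maximalAtlas hφ).mdifferentiableOn (by simp)
    obtain ⟨e, he⟩ := g.signature (φ.symm y)
    have hbij := hmd.mfderiv_bijective (x := y) hy
    set D := mfderiv (𝓡 4) (𝓡 4) φ.symm y with hD
    -- the matrix of the differential of the inverse chart with respect to the frame `e`
    let P : Matrix (Fin 4) (Fin 4) ℝ := Matrix.of fun s i =>
      e.repr (D (EuclideanSpace.single i (1 : ℝ) : Coord)) s
    have hP : ∀ c : Fin 4 → ℝ, P.mulVec c = e.repr (D (WithLp.toLp 2 c : Coord)) := by
      intro c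
      have hc : (WithLp.toLp 2 c : Coord)
          = ∑ i, c i • (EuclideanSpace.single i (1 : ℝ) : Coord) := by
        ext j
        simp [Pi.single_apply]
      have hDc : D (WithLp.toLp 2 c : Coord)
          = ∑ i, c i • D (EuclideanSpace.single i (1 : ℝ) : Coord) := by
        rw [hc]
        exact (map_sum D _ _).trans (Finset.sum_congr rfl fun i _ => map_smul D _ _)
      ext s
      rw [hDc, map_sum, Finsupp.finsetSum_apply]
      simp only [Matrix.mulVec, dotProduct, P, Matrix.of_apply, map_smul, Finsupp.smul_apply,
        smul_eq_mul]
      exact Finset.sum_congr rfl fun i _ => mul_comm _ _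
    refine ⟨P, ?_, ?_⟩
    · intro hdet
      obtain ⟨c, hc, hPc⟩ := Matrix.exists_mulVec_eq_zero_iff.2 hdet
      apply hc
      rw [hP] at hPc
      have h0 : D (WithLp.toLp 2 c : Coord) = 0 := by
        apply e.repr.injective
        ext s
        simpa using congrFun hPc s
      have h1 : (WithLp.toLp 2 c : Coord) = 0 := hbij.1 (h0.trans (map_zero D).symm)
      simpa using congrArg (WithLp.ofLp) h1
    · ext i j
      have hexp : ∀ v w : TangentSpace (𝓡 4) (φ.symm y), g.val _ v w
          = ∑ s, (if s = 0 then -1 else 1) * e.repr v s * e.repr w s := by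
        intro v w
        conv_lhs => rw [← e.sum_repr v, ← e.sum_repr w]
        simp only [map_sum, LinearMap.sum_apply, map_smul, LinearMap.smul_apply, he, smul_eq_mul]
        simp [Fin.sum_univ_four]
        ring
      change g.val _ (D _) (D _) = _
      rw [hexp, Matrix.mul_apply]
      simp [P, Matrix.mul_diagonal, Fin.sum_univ_four]

lemma isAdaptedFrame [IsManifold (𝓡 4) ∞ M] {g : LorentzMetric M} {Λ : ℝ} (hN : g.IsTypeN)
    (hE : g.IsEinstein Λ) {φ : OpenPartialHomeomorph M Coord}
    (hφ : φ ∈ IsManifold.maximalAtlas (𝓡 4) ∞ M) (S : FundamentalData φ.target (g.comp φ)) :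
    LorentzOn (g.comp φ) S.V ∧ IsAdaptedFrame S S.nullFrame (Λ / 3) := by
  have hg := (g.lorentzOn_comp hφ).mono S.V_subset
  exact ⟨hg, S.isAdaptedFrame hg (fun y hy => hE φ hφ y (S.V_subset hy))
    fun y hy => (hN φ hφ y (S.V_subset hy)).2⟩

end LorentzMetric

end Spacetime

end TypeNSpacetime

end

theorem mainTheorem5 {M : Type*} [TopologicalSpace M]
    [ChartedSpace (EuclideanSpace ℝ (Fin 4)) M] [IsManifold (𝓡 4) ∞ M]
    (g : TypeNSpacetime.LorentzMetric M) (Λ : ℝ)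
    (hN : g.IsTypeN) (hE : g.IsEinstein Λ) :
    ¬ g.IsClassC 1 ∧ ¬ g.IsClassC 3 ∧ ¬ g.IsClassC 4 ∧ ¬ g.IsClassC 6 := by
  refine ⟨fun h => h.2.2 fun φ hφ S y hy => ?_, fun h => h.2.2 fun φ hφ S y hy => ?_,
    fun h => h.2.2 fun φ hφ S y hy => ?_, fun h => h.2.2 fun φ hφ S y hy => ?_⟩
  all_goals obtain ⟨hg, hF⟩ := TypeNSpacetime.LorentzMetric.isAdaptedFrame hN hE hφ S
  · exact hF.phi1_eq_zero hg hy
  · exact hF.phi3_eq_zero hg hy (h.2.1 2 (by norm_num) φ hφ S y hy)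
  · exact hF.phi4_eq_zero hg hy (h.2.1 2 (by norm_num) φ hφ S y hy)
  · exact fun i => hF.phi6_eq_zero hg hy (h.2.1 2 (by norm_num) φ hφ S)
      (h.2.1 5 (by norm_num) φ hφ S y hy) i
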